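/- Let $n>p$ and let $G_0,G_1,\dots,G_r$ be real symmetric $p\times p$ matrices such that $G_1,\dots,G_r$ are linearly independent and $\operatorname{tr}(G_0G_i)=0$ for $i=1,\dots,r$. For $v\in\mathbb R^r$ put $\Sigma_v=G_0+\sum_{i=1}^r v_iG_i$, and let $\Theta=\{v\in\mathbb R^r:\Sigma_v\succ0\}$. Let $v^*\in\Theta$ and $\mu\in\mathbb R^p$, let $X_1,\dots,X_n$ be independent random vectors with law $\mathcal N_p(\mu,\Sigma_{v^*})$, and let $S_n=\frac1n\sum_{i=1}^n(X_i-\bar X)(X_i-\bar X)^T$, where $\bar X=\frac1n\sum_{i=1}^nX_i$, be the sample covariance matrix. Let $\hat v$ be the maximum likelihood estimator, that is, a global maximizer over $\Theta$ of $$\ell(v)=-\tfrac n2\log\det\Sigma_v-\tfrac n2\operatorname{tr}(S_n\Sigma_v^{-1})$$ (almost surely $S_n$ is nonsingular and such a maximizer exists; if it is not unique, $\hat v$ is any choice of one). Let $\varepsilon=-\frac12\log\frac12-\frac14$, and let $\psi=(\log\Gamma)'$ and $\psi_1=(\log\Gamma)''$ be the digamma and trigamma functions. Then $$\mathbb P\big(0\prec\Sigma_{\hat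 v}\prec2S_n\big)\ \ge\ 1-\frac{2(n-1)p}{n^2\varepsilon^2}-\frac{\sum_{i=1}^p\psi_1\big(\frac{n-i}2\big)+\Big(p\log\big(\frac2{n-1}\big)+\sum_{i=1}^p\psi\big(\frac{n-i}2\big)\Big)^2}{\varepsilon^2}.$$ Moreover, for fixed $p$, the right-hand side equals $1-\frac{4p}{n\varepsilon^2}+O\big(\frac1{n^2}\big)$ as $n\to\infty$. -/

import Mathlib

open MeasureTheory ProbabilityTheory Filter Asymptotics

noncomputable section

namespace LinearGaussianCovariance

/-- A linear Gaussian covariance model: symmetric `p × p` matrices `G₀, G₁, …, Gᵣ`, where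
`G₁, …, Gᵣ` are linearly independent and `G₀` is orthogonal to their span for the trace
inner product. -/
structure Model (p r : ℕ) where
  G₀ : Matrix (Fin p) (Fin p) ℝ
  G : Fin r → Matrix (Fin p) (Fin p) ℝ
  isSymm_G₀ : G₀.IsSymm
  isSymm_G : ∀ i, (G i).IsSymm
  linearIndependent : LinearIndependent ℝ G
  orthogonal : ∀ i, (G₀ * G i).trace = 0

namespace Model

variable {p r : ℕ} (M : Model p r)

/-- The covariance matrix `Σ_v = G₀ + ∑ vᵢ Gᵢ`. -/
def cov (v : Fin r → ℝ) : Matrix (Fin p) (Fin p) ℝ :=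
  M.G₀ + ∑ i, v i • M.G i

/-- The parameter space `Θ`: all `v` for which `Σ_v` is positive definite. -/
def paramSpace : Set (Fin r → ℝ) :=
  {v | (M.cov v).PosDef}

/-- The region `Δ_A = {v ∈ Θ | 0 ≺ Σ_v ≺ A}`. -/
def region (A : Matrix (Fin p) (Fin p) ℝ) : Set (Fin r → ℝ) :=
  {v | v ∈ M.paramSpace ∧ (M.cov v).PosDef ∧ (A - M.cov v).PosDef}

/-- The Gaussian log-likelihood, up to an additive constant, for sample size `n` and sample
covariance matrix `S`. -/
def logLikelihood (n : ℕ) (S : Matrix (Fin p) (Fin p) ℝ) (v : Fin r → ℝ) : ℝ :=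
  -((n : ℝ) / 2) * Real.log (M.cov v).det - (n : ℝ) / 2 * (S * (M.cov v)⁻¹).trace

/-- `v` is a maximum likelihood estimate: a global maximizer of the log-likelihood over `Θ`. -/
def IsMLE (n : ℕ) (S : Matrix (Fin p) (Fin p) ℝ) (v : Fin r → ℝ) : Prop :=
  v ∈ M.paramSpace ∧ ∀ w ∈ M.paramSpace, M.logLikelihood n S w ≤ M.logLikelihood n S v

end Model

/-- The sample mean of `x₁, …, xₙ`. -/
def sampleMean {n p : ℕ} (x : Fin n → EuclideanSpace ℝ (Fin p)) : EuclideanSpace ℝ (Fin p) :=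
  (n : ℝ)⁻¹ • ∑ i, x i

/-- The sample covariance matrix `Sₙ = (1/n) ∑ (xᵢ - x̄)(xᵢ - x̄)ᵀ`. -/
def sampleCov {n p : ℕ} (x : Fin n → EuclideanSpace ℝ (Fin p)) : Matrix (Fin p) (Fin p) ℝ :=
  (n : ℝ)⁻¹ • ∑ i, Matrix.vecMulVec
    (WithLp.ofLp (x i - sampleMean x)) (WithLp.ofLp (x i - sampleMean x))

/-- The digamma function on the reals, the derivative of `log Γ`. -/
def digamma (x : ℝ) : ℝ := deriv (fun t : ℝ => Real.log (Real.Gamma t)) x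

/-- The trigamma function on the reals, the second derivative of `log Γ`. -/
def trigamma (x : ℝ) : ℝ := deriv digamma x

/-- The constant `ε = -½ log ½ - ¼`. -/
def eps : ℝ := -(1 / 2) * Real.log (1 / 2) - 1 / 4

/-- The explicit lower bound, as a function of the sample size `n` and the dimension `p`. -/
def lowerBound (n p : ℕ) : ℝ :=
  1 - 2 * ((n : ℝ) - 1) * p / ((n : ℝ) ^ 2 * eps ^ 2)
    - (∑ i ∈ Finset.Icc 1 p, trigamma (((n : ℝ) - i) / 2)
        + (p * Real.log (2 / ((n : ℝ) - 1))
            + ∑ i ∈ Finset.Icc 1 p, digamma (((n : ℝ) - i) / 2)) ^ 2) / eps ^ 2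

end LinearGaussianCovariance

end

/-!
Write `𝓛(S, A) = tr (S A⁻¹) - log det S + log det A - p` for Stein's loss. Up to a constant and the
factor `-n/2`, the log-likelihood at `v` is `𝓛(Sₙ, Σ_v)`, so a maximum likelihood estimate minimizes
this loss over the model. In terms of the eigenvalues `lᵢ` of `A` relative to `S`, the loss is
`∑ (1/lᵢ + log lᵢ - 1)`, a sum of nonnegative terms, and a term with `lᵢ ≥ 2` is at least
`log 2 - 1/2 = 2ε`. Hence `𝓛(Sₙ, Σ_v̂) ≤ 𝓛(Sₙ, Σ_{v*}) < 2ε` forces `Σ_v̂ ≺ 2 Sₙ`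
(`posDef_of_steinLoss_lt`). The sublevel sets of the loss are compact, so the estimate exists as soon
as `Sₙ` is nonsingular (`exists_isMLE`).

It remains to bound the probability of `𝓛(Sₙ, Σ_{v*}) ≥ 2ε`. Whitening the data and centering the
columns of the data matrix shows that this loss has the law of
`tr W / n - log det W + p log n - p`, where `W` is the Gram matrix of `p` independent standard
Gaussian vectors in a space of dimension `n - 1` (`lowerBound_le_prob_goodSamples`). The trace of `W`
is a sum of independent chi-square variables. Adding the vectors one at a time gives
`E (det W)^s` as a product of ratios of Gamma values (`det_gram_stdGaussian`); the derivatives of its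
logarithm at `s = 0` are the mean and the variance of `log det W`, that is, sums of digamma and
trigamma values. Chebyshev's inequality then yields the bound (`prob_gram_le`).

For the asymptotics, the convexity of `log Γ` and the recurrence `ψ(x + 1) = ψ(x) + 1/x` give
`log x - 1/x ≤ ψ(x) ≤ log x` and, by telescoping, `1/x ≤ ψ₁(x) ≤ 1/x + 1/x²`.
-/

noncomputable section

namespace LinearGaussianCovariance

open Set Topology WithLp
open scoped Matrix RealInnerProductSpace ENNReal

/-! ### Digamma and trigamma -/

theorem analyticAt_realGamma {x : ℝ} (hx : 0 < x) : AnalyticAt ℝ Real.Gamma x := by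
  have hd : DifferentiableOn ℂ Complex.Gamma {z | 0 < z.re} := fun z hz =>
    (Complex.differentiableAt_Gamma z fun m h => by
      have h0 : 0 < z.re := hz
      rw [h] at h0
      simp only [Complex.neg_re, Complex.natCast_re] at h0
      linarith [(Nat.cast_nonneg m : (0 : ℝ) ≤ m)]).differentiableWithinAt
  have ho : IsOpen {z : ℂ | 0 < z.re} := isOpen_lt continuous_const Complex.continuous_re
  have h1 : AnalyticAt ℂ Complex.Gamma (x : ℂ) :=
    hd.analyticAt (ho.mem_nhds (by simpa using hx))
  have h2 : AnalyticAt ℝ (fun t : ℝ => Complex.reCLM (Complex.Gamma (Complex.ofRealCLM t))) x :=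
    (Complex.reCLM.analyticAt _).comp
      (AnalyticAt.comp (g := Complex.Gamma) (f := Complex.ofRealCLM) h1.restrictScalars
        (Complex.ofRealCLM.analyticAt x))
  refine h2.congr (.of_forall fun t => ?_)
  simp [Complex.Gamma_ofReal]

theorem analyticAt_logGamma {x : ℝ} (hx : 0 < x) :
    AnalyticAt ℝ (fun t : ℝ => Real.log (Real.Gamma t)) x :=
  (analyticAt_realGamma hx).log (Real.Gamma_pos_of_pos hx)

theorem differentiableAt_digamma {x : ℝ} (hx : 0 < x) : DifferentiableAt ℝ digamma x :=
  (analyticAt_logGamma hx).deriv.differentiableAt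

theorem logGamma_add_one {x : ℝ} (hx : 0 < x) :
    Real.log (Real.Gamma (x + 1)) = Real.log x + Real.log (Real.Gamma x) := by
  rw [Real.Gamma_add_one hx.ne', Real.log_mul hx.ne' (Real.Gamma_pos_of_pos hx).ne']

theorem digamma_add_one {x : ℝ} (hx : 0 < x) : digamma (x + 1) = digamma x + 1 / x := by
  have h1 : HasDerivAt (fun t : ℝ => Real.log (Real.Gamma (t + 1))) (digamma (x + 1)) x :=
    (analyticAt_logGamma (by positivity : 0 < x + 1)).differentiableAt.hasDerivAt.comp_add_const x 1
  have h2 : HasDerivAt (fun t : ℝ => Real.log t + Real.log (Real.Gamma t)) (x⁻¹ + digamma x) x :=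
    (Real.hasDerivAt_log hx.ne').add (analyticAt_logGamma hx).differentiableAt.hasDerivAt
  have h3 : (fun t : ℝ => Real.log (Real.Gamma (t + 1))) =ᶠ[𝓝 x]
      fun t : ℝ => Real.log t + Real.log (Real.Gamma t) := by
    filter_upwards [lt_mem_nhds hx] with t ht using logGamma_add_one ht
  rw [h1.unique (h2.congr_of_eventuallyEq h3), one_div, add_comm]

theorem digamma_add_nat {x : ℝ} (hx : 0 < x) (N : ℕ) :
    digamma (x + N) = digamma x + ∑ k ∈ Finset.range N, 1 / (x + k) := by
  induction N with
  | zero => simp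
  | succ N ih =>
    rw [Finset.sum_range_succ, ← add_assoc, ← ih, Nat.cast_succ, ← add_assoc,
      digamma_add_one (by positivity)]

/-- The derivative of the convex function `log Γ` at `x` is at most its increment over `[x, x + 1]`,
which is `log x`. -/
theorem digamma_le_log {x : ℝ} (hx : 0 < x) : digamma x ≤ Real.log x := by
  have h := Real.convexOn_log_Gamma.deriv_le_slope (x := x) (y := x + 1) hx
    (mem_Ioi.2 (by positivity)) (by linarith) (analyticAt_logGamma hx).differentiableAt
  simp only [slope_def_field, Function.comp_apply, logGamma_add_one hx] at h
  simpa [digamma, Function.comp_def] using h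

/-- The increment `log x` of `log Γ` over `[x, x + 1]` is at most the derivative at `x + 1`, which is
`ψ(x) + 1/x`. -/
theorem log_sub_inv_le_digamma {x : ℝ} (hx : 0 < x) : Real.log x - 1 / x ≤ digamma x := by
  have h := Real.convexOn_log_Gamma.slope_le_deriv (x := x) (y := x + 1) hx
    (mem_Ioi.2 (by positivity)) (by linarith)
    (analyticAt_logGamma (by positivity : 0 < x + 1)).differentiableAt
  simp only [slope_def_field, Function.comp_apply, logGamma_add_one hx] at h
  have h2 : Real.log x ≤ digamma (x + 1) := by simpa [digamma, Function.comp_def] using h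
  rw [digamma_add_one hx] at h2
  linarith

theorem tendsto_log_add_nat_sub {x y : ℝ} (hx : 0 < x) (hy : 0 < y) :
    Tendsto (fun N : ℕ => Real.log (y + N) - Real.log (x + N)) atTop (𝓝 0) := by
  have h1 : Tendsto (fun N : ℕ => 1 + (y - x) / (x + N)) atTop (𝓝 (1 + 0)) := by
    refine tendsto_const_nhds.add (tendsto_const_nhds.div_atTop ?_)
    exact tendsto_atTop_add_const_left _ _ tendsto_natCast_atTop_atTop
  have h2 := ((Real.continuousAt_log (by norm_num : (1 + 0 : ℝ) ≠ 0)).tendsto.comp h1)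
  simp only [add_zero, Real.log_one] at h2
  refine h2.congr fun N => ?_
  have hxN : 0 < x + N := by positivity
  have hyN : 0 < y + N := by positivity
  rw [Function.comp_apply, ← Real.log_div hyN.ne' hxN.ne']
  congr 1
  field_simp
  ring

theorem tendsto_digamma_add_nat_sub {x y : ℝ} (hx : 0 < x) (hy : 0 < y) :
    Tendsto (fun N : ℕ => digamma (y + N) - digamma (x + N)) atTop (𝓝 0) := by
  have hinv : ∀ z : ℝ, Tendsto (fun N : ℕ => 1 / (z + N)) atTop (𝓝 0) := fun z =>
    tendsto_const_nhds.div_atTop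
      (tendsto_atTop_add_const_left _ _ tendsto_natCast_atTop_atTop)
  have hl := tendsto_log_add_nat_sub hx hy
  refine tendsto_of_tendsto_of_tendsto_of_le_of_le
    (by simpa using hl.sub (hinv y)) (by simpa using hl.add (hinv x)) ?_ ?_
  · intro N
    have := log_sub_inv_le_digamma (x := y + N) (by positivity)
    have := digamma_le_log (x := x + N) (by positivity)
    simp only [one_div] at *
    linarith
  · intro N
    have := log_sub_inv_le_digamma (x := x + N) (by positivity)
    have := digamma_le_log (x := y + N) (by positivity)
    simp only [one_div] at *
    linarith

/-- The increment of `ψ` as a series, `ψ(y) - ψ(x) = ∑ (1/(x+k) - 1/(y+k))`. -/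
theorem tendsto_sum_digamma_sub {x y : ℝ} (hx : 0 < x) (hy : 0 < y) :
    Tendsto (fun N : ℕ => ∑ k ∈ Finset.range N, (1 / (x + k) - 1 / (y + k))) atTop
      (𝓝 (digamma y - digamma x)) := by
  have h := (tendsto_const_nhds (x := digamma y - digamma x)).sub
    (tendsto_digamma_add_nat_sub hx hy)
  rw [sub_zero] at h
  refine h.congr fun N => ?_
  rw [digamma_add_nat hx, digamma_add_nat hy, Finset.sum_sub_distrib]
  ring

theorem digamma_sub_le {x y : ℝ} (hx : 0 < x) (hxy : x < y) :
    digamma y - digamma x ≤ (y - x) * (1 / x + 1 / x ^ 2) := by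
  have hy := hx.trans hxy
  refine le_of_tendsto (tendsto_sum_digamma_sub hx hy) (.of_forall fun N => ?_)
  -- the terms from `k = 1` on are dominated by the telescoping `1/(x+k-1) - 1/(x+k)`
  have key : ∀ N : ℕ, ∑ k ∈ Finset.range (N + 1), (1 / (x + k) - 1 / (y + k)) ≤
      (y - x) * (1 / x + 1 / x ^ 2 - 1 / (x + N)) := by
    have term : ∀ k : ℕ, 1 / (x + k) - 1 / (y + k) ≤ (y - x) * (1 / (x + k) ^ 2) := by
      intro k
      have hxk : 0 < x + k := by positivity
      have hyk : 0 < y + k := by positivity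
      rw [div_sub_div _ _ hxk.ne' hyk.ne', mul_one_div,
        div_le_div_iff₀ (by positivity) (by positivity)]
      have : 0 ≤ (y - x) ^ 2 * (x + k) := by positivity
      nlinarith
    intro N
    induction N with
    | zero =>
      have := term 0
      simp only [zero_add, Finset.range_one, Finset.sum_singleton, Nat.cast_zero, add_zero] at *
      linarith
    | succ N ih =>
      rw [Finset.sum_range_succ]
      have h1 := term (N + 1)
      have h2 : 1 / (x + (N + 1 : ℕ)) ^ 2 ≤ 1 / (x + N) - 1 / (x + (N + 1 : ℕ)) := by
        have hxk : 0 < x + N := by positivity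
        push_cast
        rw [div_sub_div _ _ hxk.ne' (by positivity),
          div_le_div_iff₀ (by positivity) (by positivity)]
        nlinarith
      have h3 := mul_le_mul_of_nonneg_left h2 (sub_nonneg.2 hxy.le)
      linarith
  have hb : ∀ N : ℕ, (y - x) * (1 / x + 1 / x ^ 2 - 1 / (x + N)) ≤
      (y - x) * (1 / x + 1 / x ^ 2) := fun N => by
    refine mul_le_mul_of_nonneg_left ?_ (sub_nonneg.2 hxy.le)
    have : 0 ≤ 1 / (x + N) := by positivity
    linarith
  rcases N with _ | N
  · simp only [Finset.range_zero, Finset.sum_empty]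
    exact mul_nonneg (sub_nonneg.2 hxy.le) (by positivity)
  · exact (key N).trans (hb N)

theorem sub_div_le_digamma_sub {x y : ℝ} (hx : 0 < x) (hxy : x < y) :
    (y - x) * (1 / y) ≤ digamma y - digamma x := by
  have hy := hx.trans hxy
  have hlim : Tendsto (fun N : ℕ => (y - x) * (1 / y - 1 / (y + N))) atTop
      (𝓝 ((y - x) * (1 / y - 0))) :=
    (tendsto_const_nhds.sub (tendsto_const_nhds.div_atTop
      (tendsto_atTop_add_const_left _ _ tendsto_natCast_atTop_atTop))).const_mul _
  rw [sub_zero] at hlim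
  refine le_of_tendsto_of_tendsto' hlim (tendsto_sum_digamma_sub hx hy) fun N => ?_
  induction N with
  | zero => simp
  | succ N ih =>
    rw [Finset.sum_range_succ]
    have hxk : 0 < x + N := by positivity
    have hyk : 0 < y + N := by positivity
    have h2 : (y - x) * (1 / (y + N) - 1 / (y + (N + 1 : ℕ))) ≤ 1 / (x + N) - 1 / (y + N) := by
      push_cast
      rw [div_sub_div _ _ hxk.ne' hyk.ne', div_sub_div _ _ hyk.ne' (by positivity), ← mul_div_assoc,
        div_le_div_iff₀ (by positivity) (by positivity)]
      have h0 : 0 < y - x := sub_pos.2 hxy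
      have : 0 ≤ (y - x) * (y + N) * (y + 1 - x) := by
        have : 0 < y + 1 - x := by linarith
        positivity
      nlinarith
    linarith

theorem tendsto_slope_digamma {x : ℝ} (hx : 0 < x) :
    Tendsto (slope digamma x) (𝓝[>] x) (𝓝 (trigamma x)) :=
  (hasDerivAt_iff_tendsto_slope.1 (differentiableAt_digamma hx).hasDerivAt).mono_left
    (nhdsWithin_mono _ fun _ h => ne_of_gt h)

theorem trigamma_le {x : ℝ} (hx : 0 < x) : trigamma x ≤ 1 / x + 1 / x ^ 2 := by
  refine le_of_tendsto (tendsto_slope_digamma hx) ?_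
  filter_upwards [self_mem_nhdsWithin] with y hy
  rw [slope_def_field, div_le_iff₀ (sub_pos.2 hy), mul_comm]
  exact digamma_sub_le hx hy

theorem inv_le_trigamma {x : ℝ} (hx : 0 < x) : 1 / x ≤ trigamma x := by
  have hlim : Tendsto (fun y : ℝ => 1 / y) (𝓝[>] x) (𝓝 (1 / x)) :=
    (tendsto_const_nhds.div tendsto_id hx.ne').mono_left nhdsWithin_le_nhds
  refine le_of_tendsto_of_tendsto hlim (tendsto_slope_digamma hx) ?_
  filter_upwards [self_mem_nhdsWithin] with y hy
  rw [slope_def_field, le_div_iff₀ (sub_pos.2 hy), mul_comm]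
  exact sub_div_le_digamma_sub hx hy

/-! ### Asymptotics of the lower bound -/

theorem abs_trigamma_half_sub_le {p m i : ℕ} (hm : 2 * p < m) (hi : i ≤ p) :
    |trigamma (((m : ℝ) - i) / 2) - 2 / m| ≤ (4 * p + 16) / (m : ℝ) ^ 2 := by
  have hm' : 2 * (p : ℝ) < m := by exact_mod_cast hm
  have hi' : (i : ℝ) ≤ p := by exact_mod_cast hi
  have hi0 : (0 : ℝ) ≤ i := i.cast_nonneg
  have hm0 : (0 : ℝ) < m := by linarith
  have hmi : (m : ℝ) / 2 ≤ m - i := by linarith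
  have hmi0 : (0 : ℝ) < m - i := by linarith
  have hx : 0 < ((m : ℝ) - i) / 2 := by linarith
  have h1 := inv_le_trigamma hx
  have h2 := trigamma_le hx
  have h3 : 1 / (((m : ℝ) - i) / 2) = 2 / (m - i) := one_div_div _ _
  have h4 : 2 / (m : ℝ) ≤ 2 / (m - i) := div_le_div_of_nonneg_left (by norm_num) hmi0 (by linarith)
  have h5 : 2 / ((m : ℝ) - i) - 2 / m ≤ 4 * p / (m : ℝ) ^ 2 := by
    rw [div_sub_div _ _ hmi0.ne' hm0.ne', div_le_div_iff₀ (by positivity) (by positivity)]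
    have : (i : ℝ) * (m / 2) ≤ p * (m - i) := mul_le_mul hi' hmi (by positivity) (by linarith)
    nlinarith [mul_le_mul_of_nonneg_right this (by positivity : (0 : ℝ) ≤ 4 * m)]
  have h6 : 1 / (((m : ℝ) - i) / 2) ^ 2 ≤ 16 / (m : ℝ) ^ 2 := by
    rw [div_le_div_iff₀ (by positivity) (by positivity)]
    nlinarith
  rw [add_div, abs_of_nonneg (by linarith)]
  linarith

theorem abs_log_add_digamma_half_le {p m i : ℕ} (hm : 2 * p < m) (hi1 : 1 ≤ i) (hi : i ≤ p) :
    |Real.log (2 / ((m : ℝ) - 1)) + digamma (((m : ℝ) - i) / 2)| ≤ (2 * p + 2) / (m : ℝ) := by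
  have hm' : 2 * (p : ℝ) < m := by exact_mod_cast hm
  have hi' : (i : ℝ) ≤ p := by exact_mod_cast hi
  have hi0 : (1 : ℝ) ≤ i := by exact_mod_cast hi1
  have hm0 : (0 : ℝ) < m := by linarith
  have hm1 : (0 : ℝ) < m - 1 := by linarith
  have hmi : (m : ℝ) / 2 ≤ m - i := by linarith
  have hmi0 : (0 : ℝ) < m - i := by linarith
  have hx : 0 < ((m : ℝ) - i) / 2 := by linarith
  have h1 := log_sub_inv_le_digamma hx
  have h2 := digamma_le_log hx
  have h3 : Real.log (2 / ((m : ℝ) - 1)) + Real.log (((m : ℝ) - i) / 2) =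
      Real.log ((m - i) / (m - 1)) := by
    rw [← Real.log_mul (by positivity) hx.ne']
    congr 1
    field_simp
  have h4 : Real.log (((m : ℝ) - i) / (m - 1)) ≤ 0 :=
    Real.log_nonpos (by positivity) ((div_le_one hm1).2 (by linarith))
  have h5 := Real.one_sub_inv_le_log_of_pos (by positivity : 0 < ((m : ℝ) - i) / (m - 1))
  have h6 : 1 / (((m : ℝ) - i) / 2) = 2 / (m - i) := one_div_div _ _
  have h7 : -(1 - (((m : ℝ) - i) / (m - 1))⁻¹) + 2 / (m - i) ≤ (2 * p + 2) / (m : ℝ) := by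
    have : -(1 - (((m : ℝ) - i) / (m - 1))⁻¹) + 2 / (m - i) = (i + 1) / (m - i) := by
      field_simp
      ring
    rw [this, div_le_div_iff₀ hmi0 hm0]
    nlinarith
  rw [abs_of_nonpos (by linarith)]
  linarith

theorem lowerBound_isBigO (p : ℕ) :
    (fun m : ℕ => lowerBound m p - (1 - 4 * (p : ℝ) / ((m : ℝ) * eps ^ 2)))
      =O[atTop] (fun m : ℕ => 1 / (m : ℝ) ^ 2) := by
  refine IsBigO.of_bound ((2 * p + p * (4 * p + 16) + (p * (2 * p + 2)) ^ 2) / eps ^ 2) ?_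
  filter_upwards [eventually_gt_atTop (2 * p)] with m hm
  have hm0 : (0 : ℝ) < m := by exact_mod_cast (by lia : 0 < m)
  set A := ∑ i ∈ Finset.Icc 1 p, (trigamma (((m : ℝ) - i) / 2) - 2 / m) with hA
  set B := ∑ i ∈ Finset.Icc 1 p, (Real.log (2 / ((m : ℝ) - 1)) + digamma (((m : ℝ) - i) / 2))
    with hB
  have hA' : |A| ≤ p * ((4 * p + 16) / (m : ℝ) ^ 2) := by
    refine (Finset.abs_sum_le_sum_abs _ _).trans ((Finset.sum_le_card_nsmul _ _ _ fun i hi =>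
      abs_trigamma_half_sub_le hm (Finset.mem_Icc.1 hi).2).trans_eq ?_)
    simp
  have hB' : |B| ≤ p * ((2 * p + 2) / (m : ℝ)) := by
    refine (Finset.abs_sum_le_sum_abs _ _).trans ((Finset.sum_le_card_nsmul _ _ _ fun i hi =>
      abs_log_add_digamma_half_le hm (Finset.mem_Icc.1 hi).1 (Finset.mem_Icc.1 hi).2).trans_eq ?_)
    simp
  have e1 : ∑ i ∈ Finset.Icc 1 p, trigamma (((m : ℝ) - i) / 2) = A + p * (2 / m) := by
    rw [hA, Finset.sum_sub_distrib]
    simp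
  have e2 : p * Real.log (2 / ((m : ℝ) - 1)) + ∑ i ∈ Finset.Icc 1 p, digamma (((m : ℝ) - i) / 2)
      = B := by
    rw [hB, Finset.sum_add_distrib]
    simp
  have e3 : lowerBound m p - (1 - 4 * (p : ℝ) / ((m : ℝ) * eps ^ 2)) =
      (2 * p / (m : ℝ) ^ 2 - A - B ^ 2) / eps ^ 2 := by
    rw [lowerBound, e1, e2]
    by_cases he : eps = 0
    · simp [he]
    field_simp
    ring
  have hB2 : B ^ 2 ≤ (p * ((2 * p + 2) / (m : ℝ))) ^ 2 := sq_le_sq' (abs_le.1 hB').1 (abs_le.1 hB').2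
  rw [e3, Real.norm_eq_abs, Real.norm_eq_abs, abs_div, abs_of_nonneg (sq_nonneg eps),
    abs_of_pos (by positivity : 0 < 1 / (m : ℝ) ^ 2), div_mul_eq_mul_div]
  refine div_le_div_of_nonneg_right ?_ (sq_nonneg eps)
  have e4 : (2 * p + p * (4 * p + 16) + (p * (2 * p + 2)) ^ 2) * (1 / (m : ℝ) ^ 2) =
      2 * p / (m : ℝ) ^ 2 + p * ((4 * p + 16) / (m : ℝ) ^ 2) + (p * ((2 * p + 2) / (m : ℝ))) ^ 2 := by
    field_simp
  rw [e4]
  have h0 : 0 ≤ 2 * p / (m : ℝ) ^ 2 := by positivity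
  have hA1 := abs_le.1 hA'
  have hB0 := sq_nonneg B
  exact abs_le.2 ⟨by linarith, by linarith⟩

/-! ### Norms of standard Gaussian vectors -/

section StdGaussian

variable {F : Type*} [NormedAddCommGroup F] [InnerProductSpace ℝ F] [FiniteDimensional ℝ F]
  [MeasurableSpace F] [BorelSpace F]

/-- The density of the standard Gaussian measure, found by comparing characteristic functions. -/
theorem stdGaussian_eq_withDensity :
    stdGaussian F = volume.withDensity (fun x => ENNReal.ofReal
      ((2 * Real.pi) ^ (-(Module.finrank ℝ F : ℝ) / 2) * Real.exp (-(1 / 2) * ‖x‖ ^ 2))) := by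
  set c : ℝ := (2 * Real.pi) ^ (-(Module.finrank ℝ F : ℝ) / 2) with hc
  have hint : Integrable (fun x : F => c * Real.exp (-(1 / 2) * ‖x‖ ^ 2)) := by
    have := GaussianFourier.integrable_cexp_neg_mul_sq_norm_add (V := F) (b := 1 / 2)
      (by norm_num) 0 0
    refine ((this.re).const_mul c).congr (.of_forall fun x => ?_)
    have e : (-(1 / 2 : ℂ) * (‖x‖ : ℂ) ^ 2 + 0 * ((⟪(0 : F), x⟫ : ℝ) : ℂ)) =
        ((-(1 / 2) * ‖x‖ ^ 2 : ℝ) : ℂ) := by push_cast; ring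
    dsimp only
    rw [e, ← Complex.ofReal_exp, RCLike.re_eq_complex_re, Complex.ofReal_re]
  have : IsFiniteMeasure (volume.withDensity (fun x : F => ENNReal.ofReal
      (c * Real.exp (-(1 / 2) * ‖x‖ ^ 2)))) := isFiniteMeasure_withDensity_ofReal hint.2
  refine Measure.ext_of_charFun (funext fun t => ?_)
  rw [charFun_stdGaussian, charFun_apply, integral_withDensity_eq_integral_toReal_smul
    (by fun_prop) (.of_forall fun _ => ENNReal.ofReal_lt_top)]
  have h := GaussianFourier.integral_cexp_neg_mul_sq_norm_add (V := F) (b := 1 / 2)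
      (by norm_num) Complex.I t
  have e : ∀ x : F, (ENNReal.ofReal (c * Real.exp (-(1 / 2) * ‖x‖ ^ 2))).toReal •
      Complex.exp (⟪x, t⟫ * Complex.I) =
      c * Complex.exp (-(1 / 2) * ‖x‖ ^ 2 + Complex.I * ⟪t, x⟫) := by
    intro x
    rw [ENNReal.toReal_ofReal (by positivity), Complex.exp_add, real_inner_comm,
      mul_comm Complex.I]
    simp [mul_assoc]
  simp_rw [e]
  rw [integral_const_mul, h]
  have h2 : ((Real.pi : ℂ) / (1 / 2)) ^ ((Module.finrank ℝ F : ℂ) / 2) =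
      (((2 * Real.pi) ^ ((Module.finrank ℝ F : ℝ) / 2) : ℝ) : ℂ) := by
    rw [Complex.ofReal_cpow (by positivity)]
    push_cast
    congr 1
    ring
  have h3 : c * (2 * Real.pi) ^ ((Module.finrank ℝ F : ℝ) / 2) = 1 := by
    rw [hc, ← Real.rpow_add (by positivity), neg_div, neg_add_cancel, Real.rpow_zero]
  rw [h2, ← mul_assoc, ← Complex.ofReal_mul, h3, Complex.ofReal_one, one_mul, Complex.I_sq]
  congr 1
  ring

theorem lintegral_norm_sq_rpow_mul_exp [Nontrivial F] {s : ℝ} {c : ℝ} (hc : 0 ≤ c)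
    (hs : 0 < (Module.finrank ℝ F : ℝ) / 2 + s) :
    ∫⁻ x : F, ENNReal.ofReal (c * Real.exp (-(1 / 2) * ‖x‖ ^ 2)) * ENNReal.ofReal ((‖x‖ ^ 2) ^ s) =
      ENNReal.ofReal (Module.finrank ℝ F * volume.real (Metric.ball (0 : F) 1) * c / 2 *
        2 ^ ((Module.finrank ℝ F : ℝ) / 2 + s) *
        Real.Gamma ((Module.finrank ℝ F : ℝ) / 2 + s)) := by
  set d := Module.finrank ℝ F with hd
  have hd1 : 1 ≤ d := Module.finrank_pos
  let f : ℝ → ℝ := fun y => c * Real.exp (-(1 / 2) * y ^ 2) * (y ^ 2) ^ s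
  have hf : ∀ y ∈ Ioi (0 : ℝ), y ^ (d - 1) • f y =
      c * (y ^ ((d : ℝ) - 1 + 2 * s) * Real.exp (-(1 / 2) * y ^ (2 : ℝ))) := by
    intro y hy
    have hy' : 0 < y := hy
    have e1 : y ^ (d - 1) = y ^ ((d : ℝ) - 1) := by
      rw [← Real.rpow_natCast, Nat.cast_sub hd1, Nat.cast_one]
    have e2 : (y ^ 2) ^ s = y ^ (2 * s) := by
      rw [← Real.rpow_natCast, ← Real.rpow_mul hy'.le]
      norm_num
    simp only [f, smul_eq_mul]
    rw [e1, e2, Real.rpow_add hy', Real.rpow_two]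
    ring
  have hq : -1 < (d : ℝ) - 1 + 2 * s := by linarith
  have hint : Integrable (fun x : F => f ‖x‖) := by
    rw [integrable_fun_norm_addHaar]
    refine IntegrableOn.congr_fun ?_ (fun y hy => (hf y hy).symm) measurableSet_Ioi
    exact (integrableOn_rpow_mul_exp_neg_mul_rpow hq two_pos (by norm_num)).const_mul c
  have h1 : ∫ x : F, f ‖x‖ = d * volume.real (Metric.ball (0 : F) 1) * c / 2 *
        2 ^ ((d : ℝ) / 2 + s) * Real.Gamma ((d : ℝ) / 2 + s) := by
    rw [integral_fun_norm_addHaar, setIntegral_congr_fun measurableSet_Ioi hf, integral_const_mul,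
      integral_rpow_mul_exp_neg_mul_rpow two_pos hq (by norm_num)]
    have e1 : ((d : ℝ) - 1 + 2 * s + 1) / 2 = d / 2 + s := by ring
    have e2 : (1 / 2 : ℝ) ^ (-((d : ℝ) - 1 + 2 * s + 1) / 2) = 2 ^ ((d : ℝ) / 2 + s) := by
      rw [one_div, Real.inv_rpow two_pos.le, ← Real.rpow_neg two_pos.le]
      congr 1
      ring
    rw [e1, e2, ← hd, nsmul_eq_mul, smul_eq_mul]
    ring
  rw [← h1, ofReal_integral_eq_lintegral_ofReal hint (.of_forall fun x => by
    simp only [f, Pi.zero_apply]; positivity)]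
  refine lintegral_congr fun x => ?_
  rw [← ENNReal.ofReal_mul (by positivity)]

/-- The moments of the chi-square distribution, of all real orders for which they are finite. -/
theorem lintegral_norm_sq_rpow_stdGaussian [Nontrivial F] {s : ℝ}
    (hs : 0 < (Module.finrank ℝ F : ℝ) / 2 + s) :
    ∫⁻ x, ENNReal.ofReal ((‖x‖ ^ 2) ^ s) ∂(stdGaussian F) =
      ENNReal.ofReal (2 ^ s * Real.Gamma ((Module.finrank ℝ F : ℝ) / 2 + s) /
        Real.Gamma ((Module.finrank ℝ F : ℝ) / 2)) := by
  have hd : 0 < (Module.finrank ℝ F : ℝ) / 2 := by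
    have : 0 < Module.finrank ℝ F := Module.finrank_pos
    positivity
  have hc : (0 : ℝ) ≤ (2 * Real.pi) ^ (-(Module.finrank ℝ F : ℝ) / 2) := by positivity
  have key : ∀ {s : ℝ}, 0 < (Module.finrank ℝ F : ℝ) / 2 + s →
      ∫⁻ x, ENNReal.ofReal ((‖x‖ ^ 2) ^ s) ∂(stdGaussian F) =
      ENNReal.ofReal (Module.finrank ℝ F * volume.real (Metric.ball (0 : F) 1) *
        (2 * Real.pi) ^ (-(Module.finrank ℝ F : ℝ) / 2) / 2 *
        2 ^ ((Module.finrank ℝ F : ℝ) / 2 + s) *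
        Real.Gamma ((Module.finrank ℝ F : ℝ) / 2 + s)) := fun {s} hs => by
    rw [stdGaussian_eq_withDensity, lintegral_withDensity_eq_lintegral_mul _ (by fun_prop)
      (by fun_prop)]
    exact lintegral_norm_sq_rpow_mul_exp hc hs
  have h0 := key (s := 0) (by simpa using hd)
  -- order `0` fixes the normalising constant
  simp only [Real.rpow_zero, ENNReal.ofReal_one, lintegral_const, measure_univ, mul_one,
    add_zero] at h0
  have h0' := (ENNReal.ofReal_eq_one.1 h0.symm)
  have hG := (Real.Gamma_pos_of_pos hd).ne'
  rw [key hs]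
  congr 1
  rw [eq_div_iff hG, Real.rpow_add two_pos]
  linear_combination (2 ^ s * Real.Gamma ((Module.finrank ℝ F : ℝ) / 2 + s)) * h0'

/-- The chi-square distribution with `d` degrees of freedom has mean `d` and variance `2d`. -/
theorem memLp_and_variance_norm_sq_stdGaussian :
    MemLp (fun x : F => ‖x‖ ^ 2) 2 (stdGaussian F) ∧
    ∫ x, ‖x‖ ^ 2 ∂(stdGaussian F) = Module.finrank ℝ F ∧
    Var[fun x => ‖x‖ ^ 2; stdGaussian F] = 2 * Module.finrank ℝ F := by
  rcases subsingleton_or_nontrivial F with hF | hF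
  · have h0 : (fun x : F => ‖x‖ ^ 2) = 0 := by
      ext x
      simp [Subsingleton.elim x 0]
    have h1 : Module.finrank ℝ F = 0 := Module.finrank_zero_of_subsingleton
    rw [h0, h1]
    refine ⟨MemLp.zero, ?_, ?_⟩
    · simp
    · rw [variance_zero]; simp
  set d : ℝ := (Module.finrank ℝ F : ℝ) with hd
  have hd0 : 0 < d / 2 := by
    have : 0 < Module.finrank ℝ F := Module.finrank_pos
    positivity
  have hG := (Real.Gamma_pos_of_pos hd0).ne'
  have h1 := lintegral_norm_sq_rpow_stdGaussian (F := F) (s := 1) (by linarith)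
  have h2 := lintegral_norm_sq_rpow_stdGaussian (F := F) (s := 2) (by linarith)
  have e1 : 2 ^ (1 : ℝ) * Real.Gamma (d / 2 + 1) / Real.Gamma (d / 2) = d := by
    rw [Real.Gamma_add_one hd0.ne', Real.rpow_one]
    field_simp
  have e2 : 2 ^ (2 : ℝ) * Real.Gamma (d / 2 + 2) / Real.Gamma (d / 2) = d * (d + 2) := by
    rw [show d / 2 + 2 = d / 2 + 1 + 1 by ring, Real.Gamma_add_one (by positivity),
      Real.Gamma_add_one hd0.ne', Real.rpow_two]
    field_simp
  rw [← hd, e1] at h1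
  rw [← hd, e2] at h2
  simp only [Real.rpow_one, Real.rpow_two] at h1 h2
  have m1 : ∫ x, ‖x‖ ^ 2 ∂(stdGaussian F) = d := by
    rw [integral_eq_lintegral_of_nonneg_ae (.of_forall fun x => by positivity)
      (by fun_prop), h1, ENNReal.toReal_ofReal (by linarith)]
  have m2 : ∫ x, (‖x‖ ^ 2) ^ 2 ∂(stdGaussian F) = d * (d + 2) := by
    rw [integral_eq_lintegral_of_nonneg_ae (.of_forall fun x => by positivity)
      (by fun_prop), h2, ENNReal.toReal_ofReal (by nlinarith)]
  have hL : MemLp (fun x : F => ‖x‖ ^ 2) 2 (stdGaussian F) := by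
    refine (memLp_two_iff_integrable_sq (by fun_prop)).2 ⟨by fun_prop, ?_⟩
    rw [hasFiniteIntegral_iff_ofReal (.of_forall fun x => by positivity), h2]
    exact ENNReal.ofReal_lt_top
  refine ⟨hL, m1, ?_⟩
  rw [variance_eq_sub hL]
  simp only [Pi.pow_apply]
  rw [m1, m2]
  ring

end StdGaussian

/-! ### Gaussian Gram determinants -/

section Gram

variable {E : Type*} [NormedAddCommGroup E] [InnerProductSpace ℝ E]
  [FiniteDimensional ℝ E]

/-- The Gram determinant of `y, u₁, …, uₖ` is that of `u₁, …, uₖ` times the squared distance from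
`y` to the span of the `uᵢ`. -/
theorem det_gram_cons {k : ℕ} (y : E) (u : Fin k → E) :
    (Matrix.gram ℝ (Fin.cons y u : Fin (k + 1) → E)).det = (Matrix.gram ℝ u).det *
      ‖(Submodule.span ℝ (Set.range u))ᗮ.orthogonalProjectionOnto y‖ ^ 2 := by
  set K := Submodule.span ℝ (Set.range u) with hK
  set v : Fin (k + 1) → E := Fin.cons y u with hv
  set r : E := Kᗮ.orthogonalProjectionOnto y with hr
  have hrK : r ∈ Kᗮ := Submodule.coe_mem _
  have hyr : y - r ∈ K := by
    have := Kᗮ.sub_starProjection_mem_orthogonal y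
    rwa [Submodule.orthogonal_orthogonal] at this
  obtain ⟨c, hc⟩ := (Submodule.mem_span_range_iff_exists_fun ℝ).1 hyr
  set a : Fin (k + 1) → ℝ := Fin.cons 1 (-c) with ha
  have hra : r = ∑ i, a i • v i := by
    simp [ha, hv, Fin.sum_univ_succ, hc]
  have hru : ∀ i, ⟪r, u i⟫ = 0 := fun i =>
    Submodule.inner_left_of_mem_orthogonal (K := K)
      (Submodule.subset_span (Set.mem_range_self i)) hrK
  have hry : ⟪r, y⟫ = ‖r‖ ^ 2 := by
    have : ⟪r, y - r⟫ = 0 := Submodule.inner_left_of_mem_orthogonal hyr hrK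
    rw [inner_sub_right, real_inner_self_eq_norm_sq] at this
    linarith
  have h1 := Matrix.det_updateRow_sum (Matrix.gram ℝ v) 0 a
  have hrow : ∑ i, a i • Matrix.gram ℝ v i = fun j => ⟪r, v j⟫ := by
    ext j
    simp [hra, sum_inner, inner_smul_left]
  rw [hrow, ha, Fin.cons_zero, one_smul] at h1
  rw [← h1, Matrix.det_succ_row_zero, Fin.sum_univ_succ]
  have hz : ∀ i : Fin k, ⟪r, v i.succ⟫ = 0 := fun i => by simpa [hv] using hru i
  have hsub : ((Matrix.gram ℝ v).updateRow 0 fun j => ⟪r, v j⟫).submatrix Fin.succ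
      (Fin.succAbove 0) = Matrix.gram ℝ u := by
    ext i j
    simp [hv, Matrix.updateRow_apply]
  simp only [Matrix.updateRow_self, hz, hsub]
  change _ = _ * ‖r‖ ^ 2
  simp [hv, hry, mul_comm]

omit [FiniteDimensional ℝ E] in
theorem continuous_det_gram {k : ℕ} : Continuous fun u : Fin k → E => (Matrix.gram ℝ u).det := by
  refine Continuous.matrix_det (continuous_matrix fun i j => ?_)
  simp only [Matrix.gram_apply]
  fun_prop

omit [FiniteDimensional ℝ E] in
theorem det_gram_nonneg {k : ℕ} (u : Fin k → E) : 0 ≤ (Matrix.gram ℝ u).det :=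
  (Matrix.posSemidef_gram ℝ u).det_nonneg

variable [MeasurableSpace E] [BorelSpace E]

/-- Both measures have the characteristic function `t ↦ exp (-‖t‖² / 2)`. -/
theorem map_orthogonalProjection_stdGaussian (K : Submodule ℝ E) :
    (stdGaussian E).map K.orthogonalProjectionOnto = stdGaussian K := by
  refine Measure.ext_of_charFun (funext fun t => ?_)
  rw [charFun_apply, integral_map (by fun_prop) (by fun_prop), charFun_stdGaussian]
  have h := charFun_stdGaussian (t : E)
  rw [charFun_apply] at h
  simpa using h

theorem stdGaussian_singleton [Nontrivial E] (x : E) : stdGaussian E {x} = 0 := by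
  rw [stdGaussian_eq_withDensity]
  exact withDensity_absolutelyContinuous _ _ (measure_singleton x)

/-- The Gram determinant of `k` independent standard Gaussian vectors is almost surely nonzero, and
its moments are those of a product of independent chi-square variables with `m, m - 1, …` degrees of
freedom, where `m` is the dimension. The induction adds one vector `y`: given the others, its
component orthogonal to their span is standard Gaussian in a space of dimension `m - k`. -/
theorem det_gram_stdGaussian {k : ℕ} (hk : k ≤ Module.finrank ℝ E) :
    (∀ᵐ u ∂(Measure.pi fun _ : Fin k => stdGaussian E), (Matrix.gram ℝ u).det ≠ 0) ∧
    ∀ s : ℝ, (∀ i < k, 0 < ((Module.finrank ℝ E : ℝ) - i) / 2 + s) →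
      ∫⁻ u, ENNReal.ofReal ((Matrix.gram ℝ u).det ^ s)
          ∂(Measure.pi fun _ : Fin k => stdGaussian E) =
        ENNReal.ofReal (∏ i ∈ Finset.range k,
          2 ^ s * Real.Gamma (((Module.finrank ℝ E : ℝ) - i) / 2 + s) /
            Real.Gamma (((Module.finrank ℝ E : ℝ) - i) / 2)) := by
  induction k with
  | zero => simp
  | succ k ih =>
    obtain ⟨ih1, ih2⟩ := ih (by lia)
    set m := Module.finrank ℝ E with hm
    have hmp := (measurePreserving_piFinSuccAbove (fun _ : Fin (k + 1) => stdGaussian E) 0).symm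
    have hcons : ∀ z : E × (Fin k → E), (MeasurableEquiv.piFinSuccAbove (fun _ => E) 0).symm z =
        (Fin.cons z.1 z.2 : Fin (k + 1) → E) := fun z => by
      ext i
      simp [MeasurableEquiv.piFinSuccAbove]
    have hcont : Continuous fun z : E × (Fin k → E) =>
        (Matrix.gram ℝ (Fin.cons z.1 z.2 : Fin (k + 1) → E)).det :=
      continuous_det_gram.comp (by fun_prop)
    have hrank : ∀ u : Fin k → E, (Matrix.gram ℝ u).det ≠ 0 →
        Module.finrank ℝ (Submodule.span ℝ (Set.range u))ᗮ = m - k := fun u hu => by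
      have h1 := finrank_span_eq_card (Matrix.det_gram_ne_zero_iff_linearIndependent.1 hu)
      have h2 := Submodule.finrank_add_finrank_orthogonal (Submodule.span ℝ (Set.range u))
      rw [Fintype.card_fin] at h1
      lia
    have hmeas : MeasurableSet {z : E × (Fin k → E) |
        (Matrix.gram ℝ (Fin.cons z.1 z.2 : Fin (k + 1) → E)).det ≠ 0} :=
      (isOpen_ne_fun hcont continuous_const).measurableSet
    have hnt : ∀ u : Fin k → E, (Matrix.gram ℝ u).det ≠ 0 →
        Nontrivial (Submodule.span ℝ (Set.range u))ᗮ := fun u hu =>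
      Module.nontrivial_of_finrank_pos (R := ℝ) (by rw [hrank u hu]; lia)
    constructor
    · rw [← hmp.map_eq, ae_map_iff hmp.aemeasurable
        (isOpen_ne_fun continuous_det_gram continuous_const).measurableSet]
      simp only [hcons]
      refine (Measure.ae_prod_iff_ae_ae hmeas).2 ((Measure.ae_ae_comm hmeas).2 ?_)
      filter_upwards [ih1] with u hu
      have := hnt u hu
      have h0 : ∀ᵐ z ∂(stdGaussian (Submodule.span ℝ (Set.range u))ᗮ), z ≠ 0 :=
        measure_eq_zero_iff_ae_notMem.1 (stdGaussian_singleton 0)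
      rw [← map_orthogonalProjection_stdGaussian] at h0
      filter_upwards [ae_of_ae_map (by fun_prop) h0] with y hy
      rw [det_gram_cons]
      exact mul_ne_zero hu (pow_ne_zero _ (norm_ne_zero_iff.2 hy))
    · intro s hs
      rw [← hmp.map_eq, lintegral_map_equiv]
      simp only [hcons]
      rw [lintegral_prod_symm _ (hcont.measurable.pow_const s).ennreal_ofReal.aemeasurable]
      have hinner : ∀ᵐ u ∂(Measure.pi fun _ : Fin k => stdGaussian E),
          ∫⁻ y, ENNReal.ofReal ((Matrix.gram ℝ (Fin.cons y u : Fin (k + 1) → E)).det ^ s)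
            ∂(stdGaussian E) =
          ENNReal.ofReal ((Matrix.gram ℝ u).det ^ s) *
            ENNReal.ofReal (2 ^ s * Real.Gamma (((m : ℝ) - k) / 2 + s) /
              Real.Gamma (((m : ℝ) - k) / 2)) := by
        filter_upwards [ih1] with u hu
        have hr := hrank u hu
        have := hnt u hu
        have hr' : (Module.finrank ℝ (Submodule.span ℝ (Set.range u))ᗮ : ℝ) = m - k := by
          rw [hr, Nat.cast_sub (by lia)]
        simp only [det_gram_cons, Real.mul_rpow (det_gram_nonneg u) (sq_nonneg _),
          ENNReal.ofReal_mul (Real.rpow_nonneg (det_gram_nonneg u) s)]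
        rw [lintegral_const_mul _ (by fun_prop), ← hr', ← lintegral_norm_sq_rpow_stdGaussian
          (by rw [hr']; exact hs k (by lia)), ← map_orthogonalProjection_stdGaussian,
          lintegral_map (by fun_prop) (by fun_prop)]
      have hnn : 0 ≤ ∏ i ∈ Finset.range k, 2 ^ s * Real.Gamma (((m : ℝ) - i) / 2 + s) /
          Real.Gamma (((m : ℝ) - i) / 2) := by
        refine Finset.prod_nonneg fun i hi => ?_
        have hi' := Finset.mem_range.1 hi
        have : (i : ℝ) < m := by exact_mod_cast (by lia : i < m)
        have h1 := Real.Gamma_pos_of_pos (hs i (by lia))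
        have h2 := Real.Gamma_pos_of_pos (by linarith : 0 < ((m : ℝ) - i) / 2)
        positivity
      refine (lintegral_congr_ae hinner).trans ?_
      rw [lintegral_mul_const _ (continuous_det_gram.measurable.pow_const s).ennreal_ofReal]
      rw [Finset.prod_range_succ, ENNReal.ofReal_mul hnn]
      congr 1
      exact ih2 s fun i hi => hs i (by lia)

end Gram

/-! ### Moments of the trace and of the log-determinant -/

section Wishart

variable {E : Type*} [NormedAddCommGroup E] [InnerProductSpace ℝ E]
  [FiniteDimensional ℝ E] [MeasurableSpace E] [BorelSpace E]

theorem integrable_exp_mul_log_det_gram {k : ℕ} (hk : k ≤ Module.finrank ℝ E) {s : ℝ}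
    (hs : -(1 / 2) < s) :
    Integrable (fun u => Real.exp (s * Real.log (Matrix.gram ℝ u).det))
      (Measure.pi fun _ : Fin k => stdGaussian E) ∧
    mgf (fun u => Real.log (Matrix.gram ℝ u).det) (Measure.pi fun _ : Fin k => stdGaussian E) s =
      ∏ i ∈ Finset.range k, 2 ^ s * Real.Gamma (((Module.finrank ℝ E : ℝ) - i) / 2 + s) /
            Real.Gamma (((Module.finrank ℝ E : ℝ) - i) / 2) := by
  obtain ⟨h1, h2⟩ := det_gram_stdGaussian (E := E) hk
  have hpos : ∀ i < k, (1 : ℝ) / 2 ≤ ((Module.finrank ℝ E : ℝ) - i) / 2 := fun i hi => by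
    have : (i : ℝ) + 1 ≤ Module.finrank ℝ E := by exact_mod_cast (by lia)
    linarith
  have h3 := h2 s fun i hi => by linarith [hpos i hi]
  have hnn : 0 ≤ ∏ i ∈ Finset.range k, 2 ^ s * Real.Gamma (((Module.finrank ℝ E : ℝ) - i) / 2 + s) /
      Real.Gamma (((Module.finrank ℝ E : ℝ) - i) / 2) := by
    refine Finset.prod_nonneg fun i hi => ?_
    have hi' := hpos i (Finset.mem_range.1 hi)
    have h1 := Real.Gamma_pos_of_pos (by linarith : 0 < ((Module.finrank ℝ E : ℝ) - i) / 2 + s)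
    have h2 := Real.Gamma_pos_of_pos (by linarith : 0 < ((Module.finrank ℝ E : ℝ) - i) / 2)
    positivity
  have hexp : ∀ᵐ u ∂(Measure.pi fun _ : Fin k => stdGaussian E),
      (Matrix.gram ℝ u).det ^ s = Real.exp (s * Real.log (Matrix.gram ℝ u).det) := by
    filter_upwards [h1] with u hu
    rw [Real.rpow_def_of_pos ((det_gram_nonneg u).lt_of_ne' hu), mul_comm]
  have hm : Measurable fun u : Fin k → E => (Matrix.gram ℝ u).det ^ s :=
    continuous_det_gram.measurable.pow_const s
  have hnn' : ∀ u : Fin k → E, 0 ≤ (Matrix.gram ℝ u).det ^ s := fun u =>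
    Real.rpow_nonneg (det_gram_nonneg u) s
  constructor
  · refine Integrable.congr ⟨hm.aestronglyMeasurable, ?_⟩ hexp
    rw [hasFiniteIntegral_iff_ofReal (.of_forall hnn'), h3]
    exact ENNReal.ofReal_lt_top
  · rw [mgf, ← integral_congr_ae hexp, integral_eq_lintegral_of_nonneg_ae (.of_forall hnn')
      hm.aestronglyMeasurable, h3, ENNReal.toReal_ofReal hnn]

theorem zero_mem_interior_integrableExpSet_log_det_gram {k : ℕ} (hk : k ≤ Module.finrank ℝ E) :
    0 ∈ interior (integrableExpSet (fun u => Real.log (Matrix.gram ℝ u).det)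
      (Measure.pi fun _ : Fin k => stdGaussian E)) :=
  mem_interior.2 ⟨Ioi (-(1 / 2)), fun _ hs => (integrable_exp_mul_log_det_gram hk hs).1, isOpen_Ioi,
    by norm_num⟩

/-- The cumulant generating function of the log-determinant. Its first two derivatives at `0` are
the mean and the variance. -/
theorem cgf_log_det_gram {k : ℕ} (hk : k ≤ Module.finrank ℝ E) {s : ℝ} (hs : -(1 / 2) < s) :
    cgf (fun u => Real.log (Matrix.gram ℝ u).det) (Measure.pi fun _ : Fin k => stdGaussian E) s =
      ∑ i ∈ Finset.range k, (s * Real.log 2 +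
        Real.log (Real.Gamma (((Module.finrank ℝ E : ℝ) - i) / 2 + s)) -
            Real.log (Real.Gamma (((Module.finrank ℝ E : ℝ) - i) / 2))) := by
  have hpos : ∀ i ∈ Finset.range k, (1 : ℝ) / 2 ≤ ((Module.finrank ℝ E : ℝ) - i) / 2 :=
    fun i hi => by
      have hi := Finset.mem_range.1 hi
      have : (i : ℝ) + 1 ≤ Module.finrank ℝ E := by exact_mod_cast (by lia)
      linarith
  have hG1 : ∀ i ∈ Finset.range k, 0 < Real.Gamma (((Module.finrank ℝ E : ℝ) - i) / 2 + s) :=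
    fun i hi => Real.Gamma_pos_of_pos (by linarith [hpos i hi])
  have hG2 : ∀ i ∈ Finset.range k, 0 < Real.Gamma (((Module.finrank ℝ E : ℝ) - i) / 2) :=
    fun i hi => Real.Gamma_pos_of_pos (by linarith [hpos i hi])
  rw [cgf, (integrable_exp_mul_log_det_gram hk hs).2, Real.log_prod fun i hi =>
    div_ne_zero (mul_ne_zero (Real.rpow_pos_of_pos two_pos _).ne' (hG1 i hi).ne') (hG2 i hi).ne']
  refine Finset.sum_congr rfl fun i hi => ?_
  rw [Real.log_div (mul_ne_zero (Real.rpow_pos_of_pos two_pos _).ne' (hG1 i hi).ne')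
    (hG2 i hi).ne', Real.log_mul (Real.rpow_pos_of_pos two_pos _).ne' (hG1 i hi).ne',
    Real.log_rpow two_pos]

theorem deriv_cgf_log_det_gram {k : ℕ} (hk : k ≤ Module.finrank ℝ E) {s : ℝ} (hs : -(1 / 2) < s) :
    deriv (cgf (fun u => Real.log (Matrix.gram ℝ u).det)
        (Measure.pi fun _ : Fin k => stdGaussian E)) s =
      ∑ i ∈ Finset.range k, (Real.log 2 +
        digamma (((Module.finrank ℝ E : ℝ) - i) / 2 + s)) := by
  have h : HasDerivAt (fun s : ℝ => ∑ i ∈ Finset.range k, (s * Real.log 2 +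
        Real.log (Real.Gamma (((Module.finrank ℝ E : ℝ) - i) / 2 + s)) -
            Real.log (Real.Gamma (((Module.finrank ℝ E : ℝ) - i) / 2))))
      (∑ i ∈ Finset.range k, (Real.log 2 +
        digamma (((Module.finrank ℝ E : ℝ) - i) / 2 + s))) s := by
    refine HasDerivAt.fun_sum fun i hi => ?_
    have hi := Finset.mem_range.1 hi
    have hi' : (i : ℝ) + 1 ≤ Module.finrank ℝ E := by exact_mod_cast (by lia)
    have h1 : HasDerivAt (fun s : ℝ => s * Real.log 2) (Real.log 2) s := by
      simpa using (hasDerivAt_id s).mul_const (Real.log 2)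
    have h2 := (analyticAt_logGamma (by linarith :
      0 < ((Module.finrank ℝ E : ℝ) - i) / 2 + s)).differentiableAt.hasDerivAt.comp_const_add
        (((Module.finrank ℝ E : ℝ) - i) / 2) s
    exact (h1.add h2).sub_const _
  exact (h.congr_of_eventuallyEq
    ((lt_mem_nhds hs).mono fun t ht => cgf_log_det_gram hk ht)).deriv

theorem integral_log_det_gram {k : ℕ} (hk : k ≤ Module.finrank ℝ E) :
    ∫ u, Real.log (Matrix.gram ℝ u).det ∂(Measure.pi fun _ : Fin k => stdGaussian E) =
      ∑ i ∈ Finset.range k, (Real.log 2 + digamma (((Module.finrank ℝ E : ℝ) - i) / 2)) := by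
  have h := deriv_cgf_zero (zero_mem_interior_integrableExpSet_log_det_gram (E := E) hk)
  rw [deriv_cgf_log_det_gram hk (by norm_num)] at h
  simpa using h.symm

theorem variance_log_det_gram {k : ℕ} (hk : k ≤ Module.finrank ℝ E) :
    Var[fun u => Real.log (Matrix.gram ℝ u).det; Measure.pi fun _ : Fin k => stdGaussian E] =
      ∑ i ∈ Finset.range k, trigamma (((Module.finrank ℝ E : ℝ) - i) / 2) := by
  have h := variance_tilted_mul (zero_mem_interior_integrableExpSet_log_det_gram (E := E) hk)
  simp only [zero_mul, tilted_const] at h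
  rw [h, iteratedDeriv_succ, iteratedDeriv_one]
  refine (HasDerivAt.congr_of_eventuallyEq (HasDerivAt.fun_sum fun i hi => ?_)
    ((lt_mem_nhds (by norm_num : -(1 / 2) < (0 : ℝ))).mono fun t ht =>
      deriv_cgf_log_det_gram hk ht)).deriv
  have hi := Finset.mem_range.1 hi
  have hi' : (i : ℝ) + 1 ≤ Module.finrank ℝ E := by exact_mod_cast (by lia)
  have h2 := (differentiableAt_digamma (by linarith :
    0 < ((Module.finrank ℝ E : ℝ) - i) / 2 + 0)).hasDerivAt.comp_const_add
      (((Module.finrank ℝ E : ℝ) - i) / 2) 0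
  rw [add_zero] at h2
  exact h2.const_add _

theorem memLp_log_det_gram {k : ℕ} (hk : k ≤ Module.finrank ℝ E) :
    MemLp (fun u => Real.log (Matrix.gram ℝ u).det) 2
      (Measure.pi fun _ : Fin k => stdGaussian E) :=
  memLp_of_mem_interior_integrableExpSet
    (zero_mem_interior_integrableExpSet_log_det_gram hk) 2

theorem memLp_trace_gram {k : ℕ} :
    MemLp (fun u => (Matrix.gram ℝ u).trace) 2
      (Measure.pi fun _ : Fin k => stdGaussian E) := by
  simp only [Matrix.trace, Matrix.diag_apply, Matrix.gram_apply, real_inner_self_eq_norm_sq]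
  exact memLp_finsetSum _ fun i _ =>
    memLp_and_variance_norm_sq_stdGaussian.1.comp_measurePreserving (measurePreserving_eval _ i)

theorem integral_trace_gram {k : ℕ} :
    ∫ u, (Matrix.gram ℝ u).trace ∂(Measure.pi fun _ : Fin k => stdGaussian E) =
      k * Module.finrank ℝ E := by
  simp only [Matrix.trace, Matrix.diag_apply, Matrix.gram_apply, real_inner_self_eq_norm_sq]
  rw [integral_finsetSum]
  · have : ∀ i : Fin k, ∫ u, ‖u i‖ ^ 2 ∂(Measure.pi fun _ : Fin k => stdGaussian E) =
        Module.finrank ℝ E := fun i => by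
      have h := integral_map (μ := Measure.pi fun _ : Fin k => stdGaussian E)
        (measurable_pi_apply i).aemeasurable (f := fun x : E => ‖x‖ ^ 2) (by fun_prop)
      rw [← h, ← memLp_and_variance_norm_sq_stdGaussian.2.1]
      congr 1
      exact (measurePreserving_eval (fun _ : Fin k => stdGaussian E) i).map_eq
    simp [this]
  · exact fun i _ => (memLp_and_variance_norm_sq_stdGaussian.1.comp_measurePreserving
      (measurePreserving_eval (fun _ : Fin k => stdGaussian E) i)).integrable one_le_two

theorem variance_trace_gram {k : ℕ} :
    Var[fun u => (Matrix.gram ℝ u).trace; Measure.pi fun _ : Fin k => stdGaussian E] =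
      2 * (k * Module.finrank ℝ E) := by
  have h := variance_sum_pi (ι := Fin k) (μ := fun _ => stdGaussian E)
    (X := fun _ x => ‖x‖ ^ 2) fun _ => memLp_and_variance_norm_sq_stdGaussian.1
  have e : (∑ i, fun ω : Fin k → E => ‖ω i‖ ^ 2) = fun u => (Matrix.gram ℝ u).trace := by
    ext u
    simp [Matrix.trace]
  rw [← e, h, memLp_and_variance_norm_sq_stdGaussian.2.2]
  simp
  ring

end Wishart

/-! ### The tail bound -/

theorem eps_pos : 0 < eps := by
  have := Real.log_two_gt_d9
  rw [eps, one_div, Real.log_inv]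
  linarith

theorem two_mul_eps : 2 * eps = Real.log 2 + 1 / 2 - 1 := by
  rw [eps, one_div, Real.log_inv]
  ring

theorem sum_Icc_one_eq_sum_range (f : ℕ → ℝ) (p : ℕ) :
    ∑ i ∈ Finset.Icc 1 p, f i = ∑ i ∈ Finset.range p, f (i + 1) := by
  induction p with
  | zero => simp
  | succ p ih => rw [Finset.sum_Icc_succ_top (by lia), ih, Finset.sum_range_succ]

theorem integral_sub_add_const_sq_le {Ω : Type*} [MeasurableSpace Ω] {μ : Measure Ω}
    [IsProbabilityMeasure μ] {A B : Ω → ℝ} (hA : MemLp A 2 μ) (hB : MemLp B 2 μ) (c : ℝ) :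
    Integrable (fun ω => (A ω - B ω + c) ^ 2) μ ∧
    ∫ ω, (A ω - B ω + c) ^ 2 ∂μ ≤ 2 * Var[A; μ] + 2 * Var[B; μ] + (μ[A] - μ[B] + c) ^ 2 := by
  have hAB := hA.sub hB
  have hD : MemLp (fun ω => A ω - B ω + c) 2 μ := hAB.add (memLp_const c)
  have hmean : ∫ ω, (A ω - B ω + c) ∂μ = μ[A] - μ[B] + c := by
    rw [integral_add (f := fun ω => A ω - B ω) (hAB.integrable one_le_two) (integrable_const c),
      integral_sub (hA.integrable one_le_two) (hB.integrable one_le_two)]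
    simp
  have hvar : Var[fun ω => A ω - B ω + c; μ] ≤ 2 * Var[A; μ] + 2 * Var[B; μ] := by
    have h1 : Var[fun ω => A ω - B ω + c; μ] = Var[A - B; μ] :=
      variance_add_const hAB.aestronglyMeasurable c
    have h2 := variance_add hA hB
    have h3 := variance_sub hA hB
    have h4 := variance_nonneg (A + B) μ
    linarith
  have h := variance_eq_sub hD
  simp only [Pi.pow_apply, hmean] at h
  exact ⟨hD.integrable_sq, by linarith⟩

section Wishart

variable {E : Type*} [NormedAddCommGroup E] [InnerProductSpace ℝ E]
  [FiniteDimensional ℝ E] [MeasurableSpace E] [BorelSpace E]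

/-- The tail bound behind `lowerBound`: here `gram u / n` has the law of the whitened sample
covariance matrix. Chebyshev's inequality bounds the probability by a quarter of the second moment
over `eps ^ 2`. That second moment is at most twice the sum of the two variances plus the squared
mean `(δ - b) ^ 2`, where `b` is the bias of the log-determinant occurring in `lowerBound`; the
remaining factor of two absorbs the centering error `δ`. -/
theorem prob_gram_le {p n : ℕ} (hpn : p < n) (hE : Module.finrank ℝ E + 1 = n) :
    (Measure.pi fun _ : Fin p => stdGaussian E).real {u | 2 * eps ≤
      (Matrix.gram ℝ u).trace / n - Real.log (Matrix.gram ℝ u).det + (p * Real.log n - p)} ≤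
      1 - lowerBound n p := by
  rcases p.eq_zero_or_pos with rfl | hp
  -- for `p = 0` the sample size may be `1`, and the estimates below divide by `n - 1`
  · have h : ¬ 2 * eps ≤ 0 := by linarith [eps_pos]
    simp [lowerBound, Matrix.trace, h]
  set μ := Measure.pi fun _ : Fin p => stdGaussian E
  have hk : p ≤ Module.finrank ℝ E := by lia
  obtain ⟨m, hm⟩ : ∃ m : ℝ, m = Module.finrank ℝ E := ⟨_, rfl⟩
  have hnm : (n : ℝ) = m + 1 := by rw [hm, ← hE]; push_cast; rfl
  have hp1 : (1 : ℝ) ≤ p := by exact_mod_cast hp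
  have hpm : (p : ℝ) ≤ m := by rw [hm]; exact_mod_cast hk
  have hm0 : 0 < m := by linarith
  have hn0 : (0 : ℝ) < n := by linarith
  have hA : MemLp (fun u : Fin p → E => (n : ℝ)⁻¹ * (Matrix.gram ℝ u).trace) 2 μ :=
    memLp_trace_gram.const_mul _
  have hB := memLp_log_det_gram (E := E) hk
  obtain ⟨hint, hle⟩ := integral_sub_add_const_sq_le hA hB (p * Real.log n - p)
  have hmk := mul_meas_ge_le_integral_of_nonneg (μ := μ)
    (.of_forall fun u => sq_nonneg _) hint (4 * eps ^ 2)
  have hsub : {u : Fin p → E | 2 * eps ≤ (Matrix.gram ℝ u).trace / n -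
      Real.log (Matrix.gram ℝ u).det + (p * Real.log n - p)} ⊆
      {u | 4 * eps ^ 2 ≤ ((n : ℝ)⁻¹ * (Matrix.gram ℝ u).trace -
        Real.log (Matrix.gram ℝ u).det + (p * Real.log n - p)) ^ 2} := by
    intro u hu
    simp only [mem_ofPred_eq] at hu ⊢
    rw [div_eq_inv_mul] at hu
    have h := pow_le_pow_left₀ (by linarith [eps_pos] : 0 ≤ 2 * eps) hu 2
    rwa [mul_pow, show (2 : ℝ) ^ 2 = 4 by norm_num] at h
  have hmono := measureReal_mono (μ := μ) hsub
  rw [variance_const_mul, variance_trace_gram, variance_log_det_gram hk, integral_const_mul,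
    integral_trace_gram, integral_log_det_gram hk, ← hm] at hle
  set V := ∑ i ∈ Finset.range p, trigamma ((m - i) / 2) with hV
  set S := ∑ i ∈ Finset.range p, digamma ((m - i) / 2) with hS
  set b := p * Real.log (2 / m) + S with hb
  set c := m / n with hc
  have hc0 : 0 < c := by positivity
  set δ := p * (c - 1 - Real.log c) with hδ
  have he : (n : ℝ)⁻¹ * (p * m) - ∑ i ∈ Finset.range p, (Real.log 2 + digamma ((m - i) / 2)) +
      (p * Real.log n - p) = δ - b := by
    rw [Finset.sum_add_distrib, ← hS, hδ, hb, hc, Real.log_div hm0.ne' hn0.ne',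
      Real.log_div two_ne_zero hm0.ne']
    simp
    ring
  have hV0 : 0 ≤ V := Finset.sum_nonneg fun i hi => by
    have : (i : ℝ) < p := by exact_mod_cast Finset.mem_range.1 hi
    have h0 : 0 < (m - i) / 2 := by linarith
    exact (by positivity : 0 ≤ 1 / ((m - i) / 2)).trans (inv_le_trigamma h0)
  have hδ0 : 0 ≤ δ := mul_nonneg (by linarith) (by linarith [Real.log_le_sub_one_of_pos hc0])
  have hδ1 : δ ≤ p * (1 / (n * m)) := by
    refine mul_le_mul_of_nonneg_left ?_ (by linarith)
    have h1 := Real.one_sub_inv_le_log_of_pos hc0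
    have h2 : c - 1 - (1 - c⁻¹) = 1 / (n * m) := by
      rw [hc, hnm]
      field_simp
      ring
    linarith
  -- the centering error is dominated by the variance of the trace
  have hδ2 : δ ^ 2 ≤ 2 * (p * m) / n ^ 2 := by
    refine (pow_le_pow_left₀ hδ0 hδ1 2).trans ?_
    rw [mul_one_div, div_pow, div_le_div_iff₀ (by positivity) (by positivity), mul_pow]
    have h1 : 1 ≤ m := by linarith
    have h2 : (p : ℝ) ^ 2 ≤ p * m := by
      rw [pow_two]
      exact mul_le_mul_of_nonneg_left hpm (by linarith)
    have h3 : (p : ℝ) * m ≤ 2 * (p * m) * m ^ 2 := by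
      have h0 : 0 ≤ (p : ℝ) * m := by positivity
      have h4 : 1 ≤ m ^ 2 := one_le_pow₀ h1
      linarith [mul_le_mul_of_nonneg_left h4 h0]
    have h4 := mul_le_mul_of_nonneg_right (h2.trans h3) (sq_nonneg (n : ℝ))
    linarith
  have hlb : 1 - lowerBound n p = (2 * (p * m) / n ^ 2 + V + b ^ 2) / eps ^ 2 := by
    rw [lowerBound, sum_Icc_one_eq_sum_range, sum_Icc_one_eq_sum_range]
    have e1 : ∀ i : ℕ, (n : ℝ) - (i + 1 : ℕ) = m - i := fun i => by rw [hnm]; push_cast; ring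
    simp only [e1]
    rw [← hV, ← hS, show (n : ℝ) - 1 = m by rw [hnm]; ring, ← hb]
    have := eps_pos
    field_simp
    ring
  rw [he] at hle
  rw [hlb, le_div_iff₀ (pow_pos eps_pos 2)]
  have h1 : (δ - b) ^ 2 ≤ 2 * δ ^ 2 + 2 * b ^ 2 := by linarith [sq_nonneg (δ + b)]
  have h2 : 2 * (((n : ℝ)⁻¹) ^ 2 * (2 * (p * m))) = 2 * (2 * (p * m) / n ^ 2) := by
    field_simp
  have h3 := mul_le_mul_of_nonneg_left hmono (by positivity : 0 ≤ 4 * eps ^ 2)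
  have hb0 := sq_nonneg b
  linarith

end Wishart

/-! ### Stein's loss and the maximum likelihood estimate -/

section SimultaneousDiagonalization

variable {p : ℕ} {S A : Matrix (Fin p) (Fin p) ℝ}

open scoped MatrixOrder in
theorem isHermitian_sqrt (S : Matrix (Fin p) (Fin p) ℝ) : (CFC.sqrt S)ᴴ = CFC.sqrt S :=
  (CFC.sqrt_nonneg S).isSelfAdjoint.star_eq

open scoped MatrixOrder in
theorem sqrt_mul_sqrt_of_posDef (hS : S.PosDef) : CFC.sqrt S * CFC.sqrt S = S :=
  CFC.sqrt_mul_sqrt_self S hS.posSemidef.nonneg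

open scoped MatrixOrder in
theorem isUnit_sqrt_of_posDef (hS : S.PosDef) : IsUnit (CFC.sqrt S) := by
  have h := (Matrix.isUnit_iff_isUnit_det S).1 hS.isUnit
  rw [← sqrt_mul_sqrt_of_posDef hS, Matrix.det_mul] at h
  exact (Matrix.isUnit_iff_isUnit_det _).2 (isUnit_of_mul_isUnit_left h)

open scoped MatrixOrder in
/-- Two positive definite matrices are simultaneously diagonalizable by a congruence. -/
theorem exists_simultaneous_diagonalization (hS : S.PosDef) (hA : A.PosDef) :
    ∃ (R : Matrix (Fin p) (Fin p) ℝ) (l : Fin p → ℝ), IsUnit R ∧ (∀ i, 0 < l i) ∧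
      S = R * Rᴴ ∧ A = R * Matrix.diagonal l * Rᴴ := by
  set Q := CFC.sqrt S with hQ
  have hQu : IsUnit Q := isUnit_sqrt_of_posDef hS
  have hQd : IsUnit Q.det := (Matrix.isUnit_iff_isUnit_det _).1 hQu
  have hQh : Qᴴ = Q := isHermitian_sqrt S
  have hB : (Q⁻¹ * A * Q⁻¹).PosDef := by
    have h := (Matrix.IsUnit.posDef_star_left_conjugate_iff (x := A)
      ((Matrix.isUnit_nonsing_inv_iff).2 hQu)).2 hA
    rwa [Matrix.star_eq_conjTranspose, Matrix.conjTranspose_nonsing_inv, hQh] at h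
  set U : Matrix (Fin p) (Fin p) ℝ :=
    (hB.isHermitian.eigenvectorUnitary : Matrix (Fin p) (Fin p) ℝ) with hU
  have hU1 : U * Uᴴ = 1 := Unitary.coe_mul_star_self hB.isHermitian.eigenvectorUnitary
  have hUu : IsUnit U := IsUnit.of_mul_eq_one _ hU1
  have hspec : Q⁻¹ * A * Q⁻¹ = U * Matrix.diagonal hB.isHermitian.eigenvalues * Uᴴ := by
    have h := hB.isHermitian.spectral_theorem
    rw [Unitary.conjStarAlgAut_apply] at h
    rw [← Matrix.star_eq_conjTranspose]
    simpa [Function.comp_def] using h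
  refine ⟨Q * U, hB.isHermitian.eigenvalues, hQu.mul hUu, hB.eigenvalues_pos, ?_, ?_⟩
  · rw [Matrix.conjTranspose_mul, hQh, Matrix.mul_assoc, ← Matrix.mul_assoc U, hU1, Matrix.one_mul,
      sqrt_mul_sqrt_of_posDef hS]
  · calc A = Q * (Q⁻¹ * A * Q⁻¹) * Q := by
          rw [Matrix.mul_assoc Q⁻¹, ← Matrix.mul_assoc Q, Matrix.mul_nonsing_inv _ hQd,
            Matrix.one_mul, Matrix.mul_assoc, Matrix.nonsing_inv_mul _ hQd, Matrix.mul_one]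
      _ = Q * (U * Matrix.diagonal hB.isHermitian.eigenvalues * Uᴴ) * Q :=
          congrArg (fun B => Q * B * Q) hspec
      _ = _ := by
          rw [Matrix.conjTranspose_mul, hQh]
          simp only [Matrix.mul_assoc]

/-- Twice the Kullback–Leibler divergence between the centered Gaussian laws with covariances `S`
and `A` (Stein's loss). -/
def steinLoss (S A : Matrix (Fin p) (Fin p) ℝ) : ℝ :=
  (S * A⁻¹).trace - Real.log S.det + Real.log A.det - p

/-- The eigenvalues `lᵢ` of `A` relative to `S`, in terms of which both the Stein loss and the
Loewner comparison of `A` with multiples of `S` are expressed. -/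
theorem exists_relative_eigenvalues (hS : S.PosDef) (hA : A.PosDef) :
    ∃ l : Fin p → ℝ, (∀ i, 0 < l i) ∧
      steinLoss S A = ∑ i, ((l i)⁻¹ + Real.log (l i) - 1) ∧
      (∀ t : ℝ, (t • S - A).PosDef ↔ ∀ i, l i < t) ∧
      (∀ t : ℝ, (t • S - A).PosSemidef ↔ ∀ i, l i ≤ t) ∧
      (∀ t : ℝ, (A - t • S).PosSemidef ↔ ∀ i, t ≤ l i) := by
  obtain ⟨R, l, hR, hl, rfl, rfl⟩ := exists_simultaneous_diagonalization hS hA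
  have hRd : IsUnit R.det := (Matrix.isUnit_iff_isUnit_det _).1 hR
  have hRd' : IsUnit Rᴴ.det := by rw [Matrix.det_conjTranspose]; exact hRd.star
  have hdiff : ∀ t : ℝ, t • (R * Rᴴ) - R * Matrix.diagonal l * Rᴴ =
      R * Matrix.diagonal (fun i => t - l i) * star R := by
    intro t
    rw [Matrix.star_eq_conjTranspose, ← Matrix.diagonal_sub, Matrix.mul_sub, Matrix.sub_mul]
    congr 1
    rw [← Matrix.smul_one_eq_diagonal]
    simp
  have hdiff' : ∀ t : ℝ, R * Matrix.diagonal l * Rᴴ - t • (R * Rᴴ) =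
      R * Matrix.diagonal (fun i => l i - t) * star R := by
    intro t
    rw [← neg_sub, hdiff, ← Matrix.neg_mul, ← Matrix.mul_neg, Matrix.diagonal_neg]
    simp
  refine ⟨l, hl, ?_, fun t => ?_, fun t => ?_, fun t => ?_⟩
  · have hinv : R * Rᴴ * (R * Matrix.diagonal l * Rᴴ)⁻¹ =
        R * Matrix.diagonal (fun i => (l i)⁻¹) * R⁻¹ := by
      have hdi : (Matrix.diagonal l)⁻¹ = Matrix.diagonal (fun i => (l i)⁻¹) := by
        refine Matrix.inv_eq_right_inv ?_
        rw [Matrix.diagonal_mul_diagonal]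
        simp [fun i => mul_inv_cancel₀ (hl i).ne']
      rw [Matrix.mul_inv_rev, Matrix.mul_inv_rev, hdi, Matrix.mul_assoc R, ← Matrix.mul_assoc Rᴴ,
        Matrix.mul_nonsing_inv _ hRd', Matrix.one_mul, Matrix.mul_assoc]
    rw [steinLoss, hinv, Matrix.trace_mul_comm, ← Matrix.mul_assoc, Matrix.nonsing_inv_mul _ hRd,
      Matrix.one_mul, Matrix.trace_diagonal, Matrix.det_mul, Matrix.det_mul, Matrix.det_mul,
      Matrix.det_diagonal, mul_right_comm, Real.log_mul (mul_ne_zero hRd.ne_zero hRd'.ne_zero)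
        (Finset.prod_ne_zero_iff.2 fun i _ => (hl i).ne'),
      Real.log_prod fun i _ => (hl i).ne']
    simp only [Finset.sum_sub_distrib, Finset.sum_add_distrib, Finset.sum_const, Finset.card_univ,
      Fintype.card_fin, nsmul_eq_mul, mul_one]
    ring
  · rw [hdiff, Matrix.IsUnit.posDef_star_right_conjugate_iff hR, Matrix.posDef_diagonal_iff]
    simp
  · rw [hdiff, Matrix.IsUnit.posSemidef_star_right_conjugate_iff hR, Matrix.posSemidef_diagonal_iff]
    simp
  · rw [hdiff', Matrix.IsUnit.posSemidef_star_right_conjugate_iff hR,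
      Matrix.posSemidef_diagonal_iff]
    simp

theorem inv_add_log_sub_one_nonneg {x : ℝ} (hx : 0 < x) : 0 ≤ x⁻¹ + Real.log x - 1 := by
  have := Real.one_sub_inv_le_log_of_pos hx
  linarith

/-- A relative eigenvalue `l ≥ 2` alone would contribute `1/l + log l - 1 ≥ 2 * eps` to the Stein
loss, all of whose terms are nonnegative. -/
theorem posDef_of_steinLoss_lt (hS : S.PosDef) (hA : A.PosDef) (h : steinLoss S A < 2 * eps) :
    ((2 : ℝ) • S - A).PosDef := by
  obtain ⟨l, hl, hloss, h1, -, -⟩ := exists_relative_eigenvalues hS hA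
  refine (h1 2).2 fun i => ?_
  by_contra! hi
  have h2 := Finset.single_le_sum (f := fun i => (l i)⁻¹ + Real.log (l i) - 1)
    (fun i _ => inv_add_log_sub_one_nonneg (hl i)) (Finset.mem_univ i)
  have h3 := Real.one_sub_inv_le_log_of_pos (by linarith : 0 < l i / 2)
  rw [Real.log_div (hl i).ne' two_ne_zero, inv_div] at h3
  have h4 : (l i)⁻¹ ≤ 2⁻¹ := inv_anti₀ two_pos hi
  have h5 : 2 / l i = 2 * (l i)⁻¹ := div_eq_mul_inv _ _
  rw [hloss, two_mul_eps] at h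
  linarith

/-- The sublevel sets of the Stein loss are bounded, and bounded away from singular matrices. A term
`1/l + log l - 1` of the loss is at least `log l - 1` and, by `log x ≤ x/2`, at least
`1/(2l) - 1`. -/
theorem steinLoss_le_imp (hS : S.PosDef) (hA : A.PosDef) {C : ℝ} (hC : 0 ≤ C)
    (h : steinLoss S A ≤ C) : (Real.exp (C + 1) • S - A).PosSemidef ∧
      (A - (2 * (C + 1))⁻¹ • S).PosSemidef := by
  obtain ⟨l, hl, hloss, -, h1, h2⟩ := exists_relative_eigenvalues hS hA
  have h3 : ∀ i, (l i)⁻¹ + Real.log (l i) - 1 ≤ C := fun i =>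
    (Finset.single_le_sum (f := fun i => (l i)⁻¹ + Real.log (l i) - 1)
      (fun i _ => inv_add_log_sub_one_nonneg (hl i)) (Finset.mem_univ i)).trans (hloss ▸ h)
  refine ⟨(h1 _).2 fun i => ?_, (h2 _).2 fun i => ?_⟩
  · rw [← Real.log_le_iff_le_exp (hl i)]
    have := inv_pos.2 (hl i)
    linarith [h3 i]
  · rw [inv_le_comm₀ (by positivity) (hl i)]
    have h4 := Real.log_le_sub_one_of_pos (half_pos (inv_pos.2 (hl i)))
    rw [Real.log_div (inv_pos.2 (hl i)).ne' two_ne_zero, Real.log_inv] at h4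
    have h5 := Real.log_le_sub_one_of_pos two_pos
    linarith [h3 i]

theorem steinLoss_nonneg (hS : S.PosDef) (hA : A.PosDef) : 0 ≤ steinLoss S A := by
  obtain ⟨l, hl, hloss, -⟩ := exists_relative_eigenvalues hS hA
  rw [hloss]
  exact Finset.sum_nonneg fun i _ => inv_add_log_sub_one_nonneg (hl i)

end SimultaneousDiagonalization

section MLE

variable {p r : ℕ} (M : Model p r) {S : Matrix (Fin p) (Fin p) ℝ}

theorem logLikelihood_eq (n : ℕ) (S : Matrix (Fin p) (Fin p) ℝ) (v : Fin r → ℝ) :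
    M.logLikelihood n S v =
      -((n : ℝ) / 2) * (steinLoss S (M.cov v) + Real.log S.det + p) := by
  rw [Model.logLikelihood, steinLoss]
  ring

theorem logLikelihood_le_iff {n : ℕ} (hn : 0 < n) {v w : Fin r → ℝ} :
    M.logLikelihood n S w ≤ M.logLikelihood n S v ↔
      steinLoss S (M.cov v) ≤ steinLoss S (M.cov w) := by
  have hn' : (0 : ℝ) < n / 2 := by positivity
  rw [logLikelihood_eq, logLikelihood_eq, neg_mul, neg_mul, neg_le_neg_iff,
    mul_le_mul_iff_right₀ hn', add_le_add_iff_right, add_le_add_iff_right]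

theorem continuous_cov : Continuous M.cov := by
  unfold Model.cov
  fun_prop

theorem isClosed_setOf_posSemidef : IsClosed {A : Matrix (Fin p) (Fin p) ℝ | A.PosSemidef} := by
  simp only [Matrix.posSemidef_iff_dotProduct_mulVec, ofPred_and, ofPred_forall]
  refine (isClosed_eq (by fun_prop) continuous_id).inter (isClosed_iInter fun x => ?_)
  exact isClosed_le continuous_const (by fun_prop)

/-- Each entry is controlled by the quadratic form at the sums and differences of two basis
vectors. -/
theorem abs_apply_le_of_posSemidef {A B : Matrix (Fin p) (Fin p) ℝ} (hA : A.PosSemidef)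
    (hBA : (B - A).PosSemidef) (i j : Fin p) : |A i j| ≤ (B i i + B j j) / 2 := by
  have hsymm : A j i = A i j := by simpa using hA.isHermitian.apply i j
  have h1 := hA.dotProduct_mulVec_nonneg (Pi.single i 1 + Pi.single j 1)
  have h2 := hA.dotProduct_mulVec_nonneg (Pi.single i 1 - Pi.single j 1)
  have h3 := hBA.diag_nonneg (i := i)
  have h4 := hBA.diag_nonneg (i := j)
  simp [Matrix.mulVec_add, Matrix.mulVec_sub, dotProduct_add, dotProduct_sub, hsymm] at h1 h2
  rw [Matrix.sub_apply] at h3 h4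
  exact abs_le.2 ⟨by linarith, by linarith⟩

theorem isCompact_setOf_between (S : Matrix (Fin p) (Fin p) ℝ) (hS : S.PosDef) {a : ℝ} (ha : 0 < a)
    (t : ℝ) : IsCompact {A | (t • S - A).PosSemidef ∧ (A - a • S).PosSemidef} := by
  have hbox : IsCompact (Set.univ.pi fun i => Set.univ.pi fun j =>
      Icc (-(((t • S) i i + (t • S) j j) / 2)) (((t • S) i i + (t • S) j j) / 2) :
      Set (Fin p → Fin p → ℝ)) :=
    isCompact_univ_pi fun i => isCompact_univ_pi fun j => isCompact_Icc
  refine IsCompact.of_isClosed_subset hbox ?_ fun A hA i _ j _ => ?_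
  · exact (isClosed_setOf_posSemidef.preimage
      (by fun_prop : Continuous fun A : Matrix (Fin p) (Fin p) ℝ => t • S - A)).inter
      (isClosed_setOf_posSemidef.preimage
      (by fun_prop : Continuous fun A : Matrix (Fin p) (Fin p) ℝ => A - a • S))
  · have h : A.PosSemidef := by simpa using hA.2.add (hS.smul ha).posSemidef
    exact abs_le.1 (abs_apply_le_of_posSemidef h hA.1 i j)

theorem isClosedEmbedding_cov : IsClosedEmbedding M.cov := by
  have h1 : IsClosedEmbedding (Fintype.linearCombination ℝ M.G) :=
    LinearMap.isClosedEmbedding_of_injective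
      (LinearMap.ker_eq_bot.2 M.linearIndependent.fintypeLinearCombination_injective)
  have h2 := (Homeomorph.addLeft M.G₀).isClosedEmbedding.comp h1
  convert h2 using 1
  ext v
  simp [Model.cov, Fintype.linearCombination_apply]

theorem isCompact_setOf_cov_between {a : ℝ} (ha : 0 < a) (t : ℝ) (hS : S.PosDef) :
    IsCompact {v | (t • S - M.cov v).PosSemidef ∧ (M.cov v - a • S).PosSemidef} :=
  (isClosedEmbedding_cov M).isCompact_preimage (isCompact_setOf_between S hS ha t)

/-- Parameters outside the compact set of those `v` with `a • S ≼ Σ_v ≼ t • S` have larger Stein loss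
than `v₀`, for suitable `a` and `t`. -/
theorem exists_isMLE {n : ℕ} (hn : 0 < n) (hS : S.PosDef) {v₀ : Fin r → ℝ}
    (hv₀ : v₀ ∈ M.paramSpace) : ∃ v, M.IsMLE n S v := by
  set C := steinLoss S (M.cov v₀) with hC
  have hC0 : 0 ≤ C := steinLoss_nonneg hS hv₀
  have ha : 0 < (2 * (C + 1))⁻¹ := by positivity
  set K := {v | (Real.exp (C + 1) • S - M.cov v).PosSemidef ∧
    (M.cov v - (2 * (C + 1))⁻¹ • S).PosSemidef} with hK
  have hKc : IsCompact K := isCompact_setOf_cov_between M ha _ hS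
  have hKΘ : ∀ v ∈ K, (M.cov v).PosDef := fun v hv => by
    simpa using Matrix.PosDef.posSemidef_add hv.2 (hS.smul ha)
  have hcont : ContinuousOn (fun v => steinLoss S (M.cov v)) K := by
    unfold steinLoss
    intro v hv
    have hd : (M.cov v).det ≠ 0 := (hKΘ v hv).det_pos.ne'
    have hi : ContinuousAt (fun v => (M.cov v)⁻¹) v :=
      ContinuousAt.comp (g := fun A : Matrix (Fin p) (Fin p) ℝ => A⁻¹)
        (continuousAt_matrix_inv _ (by
          rw [Ring.inverse_eq_inv']
          exact continuousAt_inv₀ hd))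
        (continuous_cov M).continuousAt
    have hl : ContinuousAt (fun v => Real.log (M.cov v).det) v :=
      (continuous_cov M).matrix_det.continuousAt.log hd
    have ht : ContinuousAt (fun v => (S * (M.cov v)⁻¹).trace) v :=
      ContinuousAt.comp (g := fun A : Matrix (Fin p) (Fin p) ℝ => (S * A).trace)
        (Continuous.continuousAt (by fun_prop)) hi
    exact (((ht.sub continuousAt_const).add hl).sub continuousAt_const).continuousWithinAt
  obtain ⟨v, hvK, hv⟩ := hKc.exists_isMinOn ⟨v₀, steinLoss_le_imp hS hv₀ hC0 le_rfl⟩ hcont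
  refine ⟨v, hKΘ v hvK, fun w hw => (logLikelihood_le_iff M hn).2 ?_⟩
  by_cases hwC : steinLoss S (M.cov w) ≤ C
  · exact hv (steinLoss_le_imp hS hw hC0 hwC)
  · exact (hv (steinLoss_le_imp hS hv₀ hC0 le_rfl)).trans (not_le.1 hwC).le

end MLE

/-! ### Sample covariance matrices as Gram matrices -/

variable {n p : ℕ}

theorem continuous_columns :
    Continuous fun (z : Fin n → EuclideanSpace ℝ (Fin p)) j =>
      (toLp 2 fun k => z k j : EuclideanSpace ℝ (Fin n)) := by
  fun_prop

/-- The columns of a Gaussian matrix with independent standard Gaussian rows are themselves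
independent and standard Gaussian. -/
theorem map_transpose_pi_stdGaussian :
    (Measure.pi fun _ : Fin n => stdGaussian (EuclideanSpace ℝ (Fin p))).map
      (fun z j => toLp 2 fun k => z k j) =
      Measure.pi fun _ : Fin p => stdGaussian (EuclideanSpace ℝ (Fin n)) := by
  have : IsProbabilityMeasure
      ((Measure.pi fun _ : Fin n => stdGaussian (EuclideanSpace ℝ (Fin p))).map
      (fun z j => toLp 2 fun k => z k j : _ → Fin p → EuclideanSpace ℝ (Fin n))) :=
    Measure.isProbabilityMeasure_map continuous_columns.measurable.aemeasurable
  have hm := (continuous_columns (n := n) (p := p)).measurable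
  refine charFun_eq_pi_iff.1 fun t => ?_
  set t' : PiLp 2 (fun _ : Fin n => EuclideanSpace ℝ (Fin p)) :=
    toLp 2 fun k => toLp 2 fun j => t j k with ht'
  have h := charFun_pi (μ := fun _ : Fin n => stdGaussian (EuclideanSpace ℝ (Fin p))) t'
  rw [charFun_apply, integral_map (by fun_prop) (by fun_prop)] at h
  rw [charFun_apply, integral_map (by fun_prop) (by fun_prop),
    integral_map hm.aemeasurable (by fun_prop)]
  have hinner : ∀ z : Fin n → EuclideanSpace ℝ (Fin p),
      ⟪toLp 2 (fun j => toLp 2 fun k => z k j : Fin p → EuclideanSpace ℝ (Fin n)), t⟫ =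
        ⟪toLp 2 z, t'⟫ := fun z => by
    simp only [PiLp.inner_apply, ht']
    exact Finset.sum_comm
  simp only [hinner]
  rw [h]
  simp only [charFun_stdGaussian, ← Complex.exp_sum]
  congr 1
  rw [← Finset.sum_div, ← Finset.sum_div, Finset.sum_neg_distrib, Finset.sum_neg_distrib]
  have hs : ∑ k, ‖t' k‖ ^ 2 = ∑ j, ‖t j‖ ^ 2 := by
    simp only [EuclideanSpace.real_norm_sq_eq, ht']
    exact Finset.sum_comm
  exact_mod_cast congrArg (fun x : ℝ => ((-x / 2 : ℝ) : ℂ)) hs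

/-- The hyperplane of vectors in `ℝⁿ` whose coordinates sum to zero. -/
def centered (n : ℕ) : Submodule ℝ (EuclideanSpace ℝ (Fin n)) :=
  (ℝ ∙ (toLp 2 fun _ : Fin n => (1 : ℝ)))ᗮ

theorem finrank_centered (hn : 0 < n) : Module.finrank ℝ (centered n) + 1 = n := by
  have h := Submodule.finrank_add_finrank_orthogonal
    (ℝ ∙ (toLp 2 fun _ : Fin n => (1 : ℝ) : EuclideanSpace ℝ (Fin n)))
  rw [finrank_span_singleton, finrank_euclideanSpace_fin] at h
  · rw [centered, add_comm]
    exact h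
  · intro h0
    have := congrArg (fun x : EuclideanSpace ℝ (Fin n) => x ⟨0, hn⟩) h0
    simp at this

/-- The columns of the data matrix with rows `z₁, …, zₙ`, each centered at its mean. -/
def centeredColumns (z : Fin n → EuclideanSpace ℝ (Fin p)) (j : Fin p) : centered n :=
  (centered n).orthogonalProjectionOnto (toLp 2 fun k => z k j)

theorem centeredColumns_apply (z : Fin n → EuclideanSpace ℝ (Fin p)) (j : Fin p) (k : Fin n) :
    (centeredColumns z j : EuclideanSpace ℝ (Fin n)) k = (z k - sampleMean z) j := by
  have h : (centeredColumns z j : EuclideanSpace ℝ (Fin n)) = toLp 2 (fun k => z k j) -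
      (ℝ ∙ (toLp 2 fun _ : Fin n => (1 : ℝ) : EuclideanSpace ℝ (Fin n))).starProjection
        (toLp 2 fun k => z k j) := Submodule.starProjection_orthogonal_val _
  rw [h, Submodule.starProjection_singleton]
  simp [sampleMean, EuclideanSpace.real_norm_sq_eq, PiLp.inner_apply]
  exact div_eq_inv_mul _ _

theorem sampleCov_eq_gram (z : Fin n → EuclideanSpace ℝ (Fin p)) :
    sampleCov z = (n : ℝ)⁻¹ • Matrix.gram ℝ (centeredColumns z) := by
  ext i j
  simp only [sampleCov, Matrix.smul_apply, Matrix.gram_apply, Submodule.coe_inner,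
    PiLp.inner_apply, centeredColumns_apply, Matrix.sum_apply, Matrix.vecMulVec_apply]
  simp [mul_comm]

theorem map_centeredColumns :
    MeasurePreserving (centeredColumns (n := n) (p := p))
      (Measure.pi fun _ : Fin n => stdGaussian (EuclideanSpace ℝ (Fin p)))
      (Measure.pi fun _ : Fin p => stdGaussian (centered n)) := by
  have h1 : MeasurePreserving
      (fun (z : Fin n → EuclideanSpace ℝ (Fin p)) j => (toLp 2 fun k => z k j :
        EuclideanSpace ℝ (Fin n)))
      (Measure.pi fun _ : Fin n => stdGaussian (EuclideanSpace ℝ (Fin p)))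
      (Measure.pi fun _ : Fin p => stdGaussian (EuclideanSpace ℝ (Fin n))) :=
    ⟨continuous_columns.measurable, map_transpose_pi_stdGaussian⟩
  have h2 := measurePreserving_pi (fun _ : Fin p => stdGaussian (EuclideanSpace ℝ (Fin n)))
    (fun _ : Fin p => stdGaussian (centered n))
    (f := fun _ => (centered n).orthogonalProjectionOnto)
    fun _ => ⟨by fun_prop, map_orthogonalProjection_stdGaussian _⟩
  exact h2.comp h1

theorem sampleCov_affine (hn : 0 < n) (mean : EuclideanSpace ℝ (Fin p))
    (Q : Matrix (Fin p) (Fin p) ℝ) (z : Fin n → EuclideanSpace ℝ (Fin p)) :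
    sampleCov (fun k => mean + Matrix.toEuclideanCLM (𝕜 := ℝ) Q (z k)) =
      Q * sampleCov z * Qᵀ := by
  have hn' : (n : ℝ) ≠ 0 := by positivity
  have hmean : sampleMean (fun k => mean + Matrix.toEuclideanCLM (𝕜 := ℝ) Q (z k)) =
      mean + Matrix.toEuclideanCLM (𝕜 := ℝ) Q (sampleMean z) := by
    simp [sampleMean, Finset.sum_add_distrib, ← Nat.cast_smul_eq_nsmul ℝ, smul_smul, hn']
  have hdiff : ∀ k, ofLp (mean + Matrix.toEuclideanCLM (𝕜 := ℝ) Q (z k) -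
      sampleMean (fun k => mean + Matrix.toEuclideanCLM (𝕜 := ℝ) Q (z k))) =
      Q *ᵥ ofLp (z k - sampleMean z) := fun k => by
    rw [hmean, add_sub_add_left_eq_sub, ← map_sub, Matrix.ofLp_toEuclideanCLM]
  simp only [sampleCov, hdiff]
  rw [Matrix.mul_smul, Matrix.smul_mul, Matrix.mul_sum, Matrix.sum_mul]
  simp only [Matrix.mul_vecMulVec, Matrix.vecMulVec_mul, Matrix.vecMul_transpose]

theorem steinLoss_congr (hn : 0 < n) {Q g : Matrix (Fin p) (Fin p) ℝ} (hQ : IsUnit Q)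
    (hQs : Qᵀ = Q) (hg : g.det ≠ 0) :
    steinLoss (Q * ((n : ℝ)⁻¹ • g) * Qᵀ) (Q * Q) =
      g.trace / n - Real.log g.det + (p * Real.log n - p) := by
  have hn' : (n : ℝ) ≠ 0 := by positivity
  have hQd := (Matrix.isUnit_iff_isUnit_det _).1 hQ
  have htr : (Q * ((n : ℝ)⁻¹ • g) * Qᵀ * (Q * Q)⁻¹).trace = g.trace / n := by
    rw [hQs, Matrix.mul_inv_rev, ← Matrix.mul_assoc, Matrix.mul_assoc _ Q Q⁻¹,
      Matrix.mul_nonsing_inv _ hQd, Matrix.mul_one, Matrix.trace_mul_comm, ← Matrix.mul_assoc,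
      Matrix.nonsing_inv_mul _ hQd, Matrix.one_mul, Matrix.trace_smul, smul_eq_mul, inv_mul_eq_div]
  rw [steinLoss, htr, hQs, Matrix.det_mul, Matrix.det_mul, Matrix.det_mul, Matrix.det_smul,
    mul_right_comm, Real.log_mul (mul_ne_zero hQd.ne_zero hQd.ne_zero)
      (mul_ne_zero (by positivity) hg), Real.log_mul (by positivity) hg, Real.log_pow, Real.log_inv]
  simp
  ring

/-! ### The probability of a good sample -/

theorem continuous_sampleCov :
    Continuous (sampleCov : (Fin n → EuclideanSpace ℝ (Fin p)) → Matrix (Fin p) (Fin p) ℝ) := by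
  unfold sampleCov sampleMean
  refine continuous_matrix fun i j => ?_
  simp only [Matrix.smul_apply, Matrix.sum_apply, Matrix.vecMulVec_apply]
  fun_prop

/-- The good samples are those whose sample covariance matrix is nonsingular and has Stein loss
below `2 * eps` relative to the true covariance matrix. -/
theorem measurableSet_goodSamples (A : Matrix (Fin p) (Fin p) ℝ) :
    MeasurableSet {x : Fin n → EuclideanSpace ℝ (Fin p) |
      (sampleCov x).det ≠ 0 ∧ steinLoss (sampleCov x) A < 2 * eps} := by
  have hdet : Continuous fun x : Fin n → EuclideanSpace ℝ (Fin p) => (sampleCov x).det :=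
    continuous_sampleCov.matrix_det
  have htr : Continuous fun x : Fin n → EuclideanSpace ℝ (Fin p) => (sampleCov x * A⁻¹).trace :=
    (continuous_sampleCov.matrix_mul continuous_const).matrix_trace
  have hloss : Measurable fun x : Fin n → EuclideanSpace ℝ (Fin p) => steinLoss (sampleCov x) A :=
    ((htr.measurable.sub hdet.measurable.log).add_const _).sub_const _
  have h2 : MeasurableSet {x : Fin n → EuclideanSpace ℝ (Fin p) |
      steinLoss (sampleCov x) A < 2 * eps} := measurableSet_lt hloss measurable_const
  exact (isOpen_ne_fun hdet continuous_const).measurableSet.inter h2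

theorem posDef_sampleCov_of_det_ne_zero {x : Fin n → EuclideanSpace ℝ (Fin p)}
    (h : (sampleCov x).det ≠ 0) : (sampleCov x).PosDef := by
  have hps : (sampleCov x).PosSemidef := by
    rw [sampleCov_eq_gram]
    exact (Matrix.posSemidef_gram ℝ _).smul (by positivity)
  exact hps.posDef_iff_det_ne_zero.2 h

open scoped MatrixOrder in
/-- Whitening by the square root of `A` turns the sample covariance matrix into `gram u / n`, where
the `uⱼ` are independent standard Gaussian vectors in the `(n - 1)`-dimensional space
`centered n`. -/
theorem lowerBound_le_prob_goodSamples (hn : p < n) (mean : EuclideanSpace ℝ (Fin p))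
    {A : Matrix (Fin p) (Fin p) ℝ} (hA : A.PosDef) :
    lowerBound n p ≤ (Measure.pi fun _ : Fin n => multivariateGaussian mean A).real
      {x | (sampleCov x).det ≠ 0 ∧ steinLoss (sampleCov x) A < 2 * eps} := by
  have hn0 : 0 < n := by lia
  set Q := CFC.sqrt A with hQ
  have hQu : IsUnit Q := isUnit_sqrt_of_posDef hA
  have hQd := ((Matrix.isUnit_iff_isUnit_det _).1 hQu).ne_zero
  have hQs : Qᵀ = Q := by simpa using isHermitian_sqrt A
  have hQQ : Q * Q = A := sqrt_mul_sqrt_of_posDef hA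
  have hmap : (Measure.pi fun _ : Fin n => multivariateGaussian mean A) =
      (Measure.pi fun _ : Fin n => stdGaussian (EuclideanSpace ℝ (Fin p))).map
        (fun z k => mean + Matrix.toEuclideanCLM (𝕜 := ℝ) Q (z k)) := by
    rw [Measure.pi_map_pi (f := fun _ z => mean + Matrix.toEuclideanCLM (𝕜 := ℝ) Q z)
      fun _ => by fun_prop]
    rfl
  set D : (Fin p → centered n) → ℝ := fun u =>
    (Matrix.gram ℝ u).trace / n - Real.log (Matrix.gram ℝ u).det + (p * Real.log n - p) with hD
  set H : Set (Fin p → centered n) := {u | (Matrix.gram ℝ u).det ≠ 0 ∧ D u < 2 * eps} with hH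
  have hDm : Measurable D :=
    (((continuous_finsetSum _ fun i _ => by
      simp only [Matrix.diag_apply, Matrix.gram_apply]; fun_prop : Continuous fun u :
        Fin p → centered n => (Matrix.gram ℝ u).trace).measurable.div_const _).sub
      continuous_det_gram.measurable.log).add_const _
  have hHm : MeasurableSet H :=
    (isOpen_ne_fun continuous_det_gram continuous_const).measurableSet.inter
      (measurableSet_lt hDm measurable_const)
  have hpre : (fun (z : Fin n → EuclideanSpace ℝ (Fin p)) k =>
      mean + Matrix.toEuclideanCLM (𝕜 := ℝ) Q (z k)) ⁻¹'
        {x | (sampleCov x).det ≠ 0 ∧ steinLoss (sampleCov x) A < 2 * eps} =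
      centeredColumns ⁻¹' H := by
    ext z
    have hdet : (sampleCov fun k => mean + Matrix.toEuclideanCLM (𝕜 := ℝ) Q (z k)).det ≠ 0 ↔
        (Matrix.gram ℝ (centeredColumns z)).det ≠ 0 := by
      rw [sampleCov_affine hn0, sampleCov_eq_gram, Matrix.det_mul, Matrix.det_mul, Matrix.det_smul,
        Matrix.det_transpose]
      simp [hQd, hn0.ne']
    simp only [mem_preimage, mem_ofPred_eq, hH, hdet]
    refine and_congr_right fun hg => ?_
    rw [sampleCov_affine hn0, sampleCov_eq_gram, ← hQQ, steinLoss_congr hn0 hQu hQs hg]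
  have hfin := finrank_centered hn0
  have hp : p ≤ Module.finrank ℝ (centered n) := Nat.le_of_lt_succ (hn.trans_eq hfin.symm)
  have hprob := prob_gram_le (E := centered n) hn hfin
  have hcompl : (Measure.pi fun _ : Fin p => stdGaussian (centered n)).real Hᶜ ≤
      (Measure.pi fun _ : Fin p => stdGaussian (centered n)).real {u | 2 * eps ≤ D u} := by
    refine ENNReal.toReal_mono (measure_ne_top _ _) (measure_mono_ae ?_)
    filter_upwards [(det_gram_stdGaussian hp).1] with u hu hc
    by_contra hlt
    exact hc ⟨hu, not_le.1 hlt⟩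
  rw [probReal_compl_eq_one_sub hHm] at hcompl
  rw [hmap, map_measureReal_apply (by fun_prop) (measurableSet_goodSamples A), hpre,
    map_centeredColumns.measureReal_preimage hHm.nullMeasurableSet]
  linarith

end LinearGaussianCovariance

end

theorem mainTheorem3 {p r : ℕ} (M : LinearGaussianCovariance.Model p r)
    (vstar : Fin r → ℝ) (hvstar : vstar ∈ M.paramSpace) (mean : EuclideanSpace ℝ (Fin p))
    {n : ℕ} (hn : p < n)
    {Ω : Type*} [MeasurableSpace Ω] (P : Measure Ω) [IsProbabilityMeasure P]
    (X : Fin n → Ω → EuclideanSpace ℝ (Fin p))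
    (hindep : iIndepFun X P)
    (hlaw : ∀ i, HasLaw (X i) (multivariateGaussian mean (M.cov vstar)) P)
    (vhat : Ω → Fin r → ℝ)
    (hvhat : ∀ᵐ ω ∂P, (LinearGaussianCovariance.sampleCov fun i => X i ω).PosDef →
      (∃ v, M.IsMLE n (LinearGaussianCovariance.sampleCov fun i => X i ω) v) →
      M.IsMLE n (LinearGaussianCovariance.sampleCov fun i => X i ω) (vhat ω)) :
    LinearGaussianCovariance.lowerBound n p ≤
        P.real {ω | vhat ω ∈
          M.region ((2 : ℝ) • LinearGaussianCovariance.sampleCov fun i => X i ω)} ∧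
      (fun m : ℕ => LinearGaussianCovariance.lowerBound m p -
          (1 - 4 * (p : ℝ) / ((m : ℝ) * LinearGaussianCovariance.eps ^ 2)))
        =O[atTop] (fun m : ℕ => 1 / (m : ℝ) ^ 2) := by
  refine ⟨?_, LinearGaussianCovariance.lowerBound_isBigO p⟩
  have hXm : ∀ i, AEMeasurable (X i) P := fun i => (hlaw i).aemeasurable
  have hjoint : P.map (fun ω i => X i ω) =
      Measure.pi fun _ : Fin n => multivariateGaussian mean (M.cov vstar) := by
    rw [(iIndepFun_iff_map_fun_eq_pi_map hXm).1 hindep]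
    simp only [fun i => (hlaw i).map_eq]
  refine (LinearGaussianCovariance.lowerBound_le_prob_goodSamples hn mean hvstar).trans ?_
  rw [← hjoint, map_measureReal_apply_of_aemeasurable (aemeasurable_pi_lambda _ hXm)
    (LinearGaussianCovariance.measurableSet_goodSamples _)]
  refine ENNReal.toReal_mono (measure_ne_top _ _) (measure_mono_ae ?_)
  filter_upwards [hvhat] with ω hω hgood
  have hS := LinearGaussianCovariance.posDef_sampleCov_of_det_ne_zero hgood.1
  have hmle := hω hS (LinearGaussianCovariance.exists_isMLE M (by lia) hS hvstar)
  refine ⟨hmle.1, hmle.1, LinearGaussianCovariance.posDef_of_steinLoss_lt hS hmle.1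
    (lt_of_le_of_lt ?_ hgood.2)⟩
  exact (LinearGaussianCovariance.logLikelihood_le_iff M (by lia)).1 (hmle.2 vstar hvstar)
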